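/- Let $d\in\mathbb N$, $\alpha_i,\nu_i>0$ and $H_i\in(0,1)\setminus\{1/2\}$ for $i=1,\dots,d$. Let $B=(B^1_t,\dots,B^d_t)_{t\in\mathbb R}$ be a $d$-variate fractional Brownian motion: a centered Gaussian process such that each $B^i$ is a fractional Brownian motion with Hurst index $H_i$, normalized by $\operatorname{Var}(B^i_1)=1$ and with almost surely continuous paths, such that $(B^i_{\lambda t})_{i,t}$ and $(\lambda^{H_i}B^i_t)_{i,t}$ have the same finite-dimensional distributions for every $\lambda>0$, and such that the increments of $B$ are stationary. Let $Y=(Y^1_t,\dots,Y^d_t)_{t\in\mathbb R}$ be the multivariate fractional Ornstein–Uhlenbeck process, i.e. the centered Gaussian process with $$Y^i_t=\nu_i\int_{-\infty}^t e^{-\alpha_i(t-s)}\,dB^i_s ,$$ the integral being a pathwise (improper) Riemann–Stieltjes integral. Write $H_{ij}=H_i+H_j$, and put $\operatorname{sign}(x)=1$ for $x\ge 0$ and $\operatorname{sign}(x)=-1$ for $x<0$. There are real numbers $\rho_{ij}=\rho_{ji}$ and $\eta_{ij}=-\eta_{ji}$ ($i\ne j$), the cross-correlation parameters of $B$, such that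 $\rho_{ij}=\operatorname{Corr}(B^i_1,B^j_1)$ and, for all $t,s\in\mathbb R$, $$\operatorname{Cov}(B^i_t,B^j_s)=\tfrac12\big((\rho_{ij}+\operatorname{sign}(t)\eta_{ij})|t|^{H_{ij}}+(\rho_{ij}-\operatorname{sign}(s)\eta_{ij})|s|^{H_{ij}}-(\rho_{ij}-\operatorname{sign}(s-t)\eta_{ij})|s-t|^{H_{ij}}\big)\quad\text{if } H_{ij}\ne1,$$ $$\operatorname{Cov}(B^i_t,B^j_s)=\tfrac12\big(\rho_{ij}(|s|+|t|-|s-t|)+\eta_{ij}(s\log|s|-t\log|t|-(s-t)\log|s-t|)\big)\quad\text{if } H_{ij}=1,$$ with the convention $0\log 0=0$. **Theorem 2.3.** With these parameters, let $i\neq j$, $N\in\mathbb N=\{0,1,2,\dots\}$ and $t\in\mathbb R$. If $H_{ij}\neq1$, then, as $s\to\infty$, $$\operatorname{Cov}(Y^i_t,Y^j_{t+s})=\frac{\nu_i\nu_j(\rho_{ij}+\eta_{ji})}{2(\alpha_i+\alpha_j)}\sum_{n=0}^N\Big(\frac{(-1)^n}{\alpha_j^{n+1}}+\frac1{\alpha_i^{n+1}}\Big)\Big(\prod_{k=0}^{n+1}(H_{ij}-k)\Big)s^{H_{ij}-2-n}+O\big(s^{H_{ij}-N-3}\big).$$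 If $H_{ij}=1$, then, as $s\to\infty$, $$\operatorname{Cov}(Y^i_t,Y^j_{t+s})=\frac{\nu_i\nu_j\eta_{ij}}{2\alpha_i\alpha_j}\,\frac1s+\frac{\nu_i\nu_j\eta_{ij}}{2(\alpha_i+\alpha_j)}\sum_{n=1}^N\Big(\frac{(-1)^n}{\alpha_j^{n+1}}+\frac1{\alpha_i^{n+1}}\Big)\Big(\prod_{k=0}^{n-1}(-k-1)\Big)s^{-1-n}+O\big(s^{-N-2}\big).$$ -/

import Mathlib

open MeasureTheory ProbabilityTheory Filter Asymptotics Topology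

/-- `I` is the Riemann-Stieltjes integral `∫_a^b f dg`: the sums over tagged partitions
`a = x 0 ≤ ξ 0 ≤ x 1 ≤ ξ 1 ≤ … ≤ x n = b` converge to `I` as the mesh tends to `0`. -/
def HasRSIntegral (f g : ℝ → ℝ) (a b I : ℝ) : Prop :=
  ∀ ε : ℝ, 0 < ε → ∃ δ : ℝ, 0 < δ ∧
    ∀ (n : ℕ) (x ξ : ℕ → ℝ), x 0 = a → x n = b →
      (∀ k < n, x k ≤ ξ k ∧ ξ k ≤ x (k + 1) ∧ x (k + 1) - x k < δ) →
      |∑ k ∈ Finset.range n, f (ξ k) * (g (x (k + 1)) - g (x k)) - I| < ε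

/-- `I` is the improper Riemann-Stieltjes integral `∫_{-∞}^b f dg`, the limit of
`∫_a^b f dg` as `a → -∞`. -/
def HasImproperRSIntegral (f g : ℝ → ℝ) (b I : ℝ) : Prop :=
  ∃ J : ℝ → ℝ, (∀ a ≤ b, HasRSIntegral f g a b (J a)) ∧ Tendsto J atBot (𝓝 I)

/-- A (two-sided) fractional Brownian motion with Hurst index `h`, normalized so that its
variance at time `1` is `1`. -/
structure IsFBM {Ω : Type*} [MeasurableSpace Ω] (h : ℝ) (X : ℝ → Ω → ℝ) (P : Measure Ω) :
    Prop where
  gaussian : IsGaussianProcess X P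
  centered : ∀ t, ∫ ω, X t ω ∂P = 0
  covariance_eq : ∀ t s,
    covariance (X t) (X s) P =
      (1 / 2) * (|t| ^ (2 * h) + |s| ^ (2 * h) - |t - s| ^ (2 * h))
  continuous_paths : ∀ᵐ ω ∂P, Continuous fun t => X t ω

/-- A `d`-variate fractional Brownian motion `(B t) = (B 1 t, …, B d t)`, `t ∈ ℝ`, with Hurst
indices `H i`, normalized so that every component has variance `1` at time `1`: a centered
Gaussian process whose components are fractional Brownian motions, which is self-similar with
parameter `H` and has stationary increments, both in the sense of finite-dimensional
distributions. -/
structure IsMFBM {Ω : Type*} [MeasurableSpace Ω] {d : ℕ} (H : Fin d → ℝ)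
    (B : Fin d → ℝ → Ω → ℝ) (P : Measure Ω) : Prop where
  gaussian : IsGaussianProcess (fun (p : Fin d × ℝ) => B p.1 p.2) P
  component : ∀ i, IsFBM (H i) (B i) P
  self_similar : ∀ l : ℝ, 0 < l → ∀ T : Finset ℝ,
    IdentDistrib (fun ω (t : T) (i : Fin d) => B i (l * t) ω)
      (fun ω (t : T) (i : Fin d) => l ^ (H i) * B i t ω) P P
  stationary_increments : ∀ h : ℝ, ∀ T : Finset ℝ,
    IdentDistrib (fun ω (t : T) (i : Fin d) => B i (t + h) ω - B i h ω)
      (fun ω (t : T) (i : Fin d) => B i t ω - B i 0 ω) P P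

/-- The multivariate fractional Ornstein-Uhlenbeck process driven by `B`: a centered Gaussian
process with `Y i t = ν i * ∫_{-∞}^t exp (-α i * (t - s)) dB i s`, the integral being a pathwise
Riemann-Stieltjes integral. -/
structure IsMFOU {Ω : Type*} [MeasurableSpace Ω] {d : ℕ} (α ν H : Fin d → ℝ)
    (B Y : Fin d → ℝ → Ω → ℝ) (P : Measure Ω) : Prop where
  mfbm : IsMFBM H B P
  gaussian : IsGaussianProcess (fun (p : Fin d × ℝ) => Y p.1 p.2) P
  centered : ∀ i t, ∫ ω, Y i t ω ∂P = 0
  integral_eq : ∀ i t, ∀ᵐ ω ∂P, ∃ I : ℝ,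
    HasImproperRSIntegral (fun s => Real.exp (-(α i * (t - s)))) (fun s => B i s ω) t I ∧
      Y i t ω = ν i * I

/-- The sign with the convention `sign 0 = 1`. -/
noncomputable def sgn (x : ℝ) : ℝ := if 0 ≤ x then 1 else -1

/-- The cross-covariance `Cov (B^i_t, B^j_s)` of a normalized multivariate fractional Brownian
motion with `H_i + H_j = h`, `ρ_ij = r` and `η_ij = e`. -/
noncomputable def mfbmCrossCov (h r e t s : ℝ) : ℝ :=
  if h = 1 then
    (1 / 2) * (r * (|s| + |t| - |s - t|) +
      e * (s * Real.log |s| - t * Real.log |t| - (s - t) * Real.log |s - t|))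
  else
    (1 / 2) * ((r + sgn t * e) * |t| ^ h + (r - sgn s * e) * |s| ^ h -
      (r - sgn (s - t) * e) * |s - t| ^ h)

/-- `ρ` and `η` are the cross-correlation parameters of the multivariate fractional Brownian
motion `B`. They are determined by `B` off the diagonal and are not used on the diagonal. -/
structure IsCrossParam {Ω : Type*} [MeasurableSpace Ω] {d : ℕ} (H : Fin d → ℝ)
    (B : Fin d → ℝ → Ω → ℝ) (P : Measure Ω) (ρ η : Fin d → Fin d → ℝ) : Prop where
  rho_symm : ∀ i j, i ≠ j → ρ i j = ρ j i
  eta_antisymm : ∀ i j, i ≠ j → η i j = -η j i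
  rho_eq_corr : ∀ i j, i ≠ j →
    ρ i j = covariance (B i 1) (B j 1) P /
      (Real.sqrt (variance (B i 1) P) * Real.sqrt (variance (B j 1) P))
  covariance_eq : ∀ i j, i ≠ j → ∀ t s,
    covariance (B i t) (B j s) P = mfbmCrossCov (H i + H j) (ρ i j) (η i j) t s

/-!
The theorem describes a Gaussian process through its covariance, so the proof is a computation of
covariances followed by an asymptotic analysis of exponential averages.

*Existence of the parameters.* Write `γ t s = Cov (B^i_t, B^j_s)` and `h = H_i + H_j`. Stationary
increments and self-similarity give the symmetric part `γ t s + γ s t` at once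
(`IsMFBM.covariance_add_covariance_swap`). The antisymmetric part `δ` satisfies
`δ x y + δ y u + δ u x = δ (x - u) (y - u)` and is homogeneous of degree `h`. Such functions form a
space of dimension at most one: for `h ≠ 1` this is pure algebra
(`IsHomogCocycle.eq_zero_of_ne_one`), and for `h = 1`, where the solution is an entropy function,
continuity and the maximum principle decide (`IsHomogCocycle.eq_zero_of_continuous`). Since
`sgn x * |x| ^ h` and, for `h = 1`, `x * log |x|` yield nonzero solutions, `γ` has the asserted
form with `η` a quotient of two values.

*The covariance of `Y`.* With `C x = (ρ - sgn x * η) * |x| ^ h`, or `ρ * |x| + η * x * log |x|` if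
`h = 1`, one has `γ t s = (C (-t) + C s - C (s - t)) / 2`. Integration by parts turns the pathwise
integral into the average of `B^i_t - B^i_{t - x}` over an exponentially distributed `x`
(`HasImproperRSIntegral.eq_integral_expMeasure`), and Fubini gives the covariance of `Y` as an
average of covariances of increments. The double average of `C (s + x - y)` reduces to single ones,
because the difference of two independent exponential variables is distributed as a mixture of
these variables and their negatives (`integral_integral_comp_sub_add`). This leaves
`ν_i ν_j / 2 * ((α_i E C (s + X_i) + α_j E C (s - X_j)) / (α_i + α_j) - C s)` with `X_i`, `X_j`
exponential of rates `α_i`, `α_j` (`IsMFOU.covariance_eq_integral_expMeasure`).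

*Asymptotics.* Repeated integration by parts expands `E C (s ± X)` in the derivatives of `C` at `s`
(`integral_expMeasure_sub_sum_isBigO`). The contribution of `X > s / 2`, where `C` need not be
smooth, is exponentially small, and on `X ≤ s / 2` the remainder is controlled by a derivative of
high order. The terms of orders `0` and `1` cancel and the others are those of the theorem.
-/

/-! ### Homogeneous cocycles -/

/-- The properties of the antisymmetric part `δ x y = Cov (X x) (Z y) - Cov (X y) (Z x)` of the
cross-covariance of two jointly self-similar processes with jointly stationary increments: it is
an antisymmetric cocycle and homogeneous of degree `h`. -/
structure IsHomogCocycle (h : ℝ) (δ : ℝ → ℝ → ℝ) : Prop where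
  anti : ∀ x y, δ x y = -δ y x
  cocycle : ∀ x y u, δ x y + δ y u + δ u x = δ (x - u) (y - u)
  homog : ∀ l, 0 < l → ∀ x y, δ (l * x) (l * y) = l ^ h * δ x y

namespace IsHomogCocycle

variable {h : ℝ} {δ : ℝ → ℝ → ℝ}

lemma neg (hδ : IsHomogCocycle h δ) : IsHomogCocycle h (fun x y => -δ x y) where
  anti x y := by rw [hδ.anti x y]
  cocycle x y u := by rw [← hδ.cocycle x y u]; ring
  homog l hl x y := by rw [hδ.homog l hl]; ring

lemma sub {δ' : ℝ → ℝ → ℝ} (hδ : IsHomogCocycle h δ) (hδ' : IsHomogCocycle h δ') :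
    IsHomogCocycle h (fun x y => δ x y - δ' x y) where
  anti x y := by rw [hδ.anti x y, hδ'.anti x y]; ring
  cocycle x y u := by rw [← hδ.cocycle x y u, ← hδ'.cocycle x y u]; ring
  homog l hl x y := by rw [hδ.homog l hl, hδ'.homog l hl]; ring

lemma const_mul (hδ : IsHomogCocycle h δ) (c : ℝ) : IsHomogCocycle h (fun x y => c * δ x y) where
  anti x y := by rw [hδ.anti x y]; ring
  cocycle x y u := by rw [← hδ.cocycle x y u]; ring
  homog l hl x y := by rw [hδ.homog l hl]; ring

lemma self_eq_zero (hδ : IsHomogCocycle h δ) (x : ℝ) : δ x x = 0 := by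
  linarith [hδ.anti x x]

lemma apply_zero_right (hδ : IsHomogCocycle h δ) (x : ℝ) : δ x 0 = 0 := by
  have h1 := hδ.cocycle 0 x 0
  simp only [sub_zero] at h1
  linarith [hδ.self_eq_zero 0]

/-- A symmetry of order three, up to which `δ` is determined by its values on `0 ≤ y ≤ x`. -/
lemma apply_rotate (hδ : IsHomogCocycle h δ) (x y : ℝ) : δ x y = δ (-y) (x - y) := by
  have h1 := hδ.cocycle 0 x y
  rw [zero_sub] at h1
  linarith [hδ.anti 0 x, hδ.apply_zero_right x, hδ.apply_zero_right y]

/-- The gap form `G p q = δ (p + q) q` of `δ` is a 2-cocycle on the additive group `ℝ`. -/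
lemma gap_cocycle (hδ : IsHomogCocycle h δ) (p q u : ℝ) :
    δ (p + q + u) (p + u) + δ (p + u) u = δ (p + q + u) u + δ (p + q) p := by
  have h1 := hδ.cocycle (p + q + u) (p + u) u
  simp only [add_sub_cancel_right] at h1
  linarith [hδ.anti u (p + q + u)]

/-- The gap form of `δ` is symmetric: its antisymmetric part is biadditive, hence
homogeneous of degree `2` under doubling, while `δ` has degree `h < 2`. -/
lemma gap_symm (hδ : IsHomogCocycle h δ) (hh : h < 2) (p q : ℝ) :
    δ (p + q) q = δ (p + q) p := by
  have add : ∀ p q u, (δ (p + q + u) u - δ (p + q + u) (p + q)) =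
      (δ (p + u) u - δ (p + u) p) + (δ (q + u) u - δ (q + u) q) := by
    intro p q u
    have h1 := hδ.gap_cocycle p q u
    have h2 := hδ.gap_cocycle q u p
    have h3 := hδ.gap_cocycle u q p
    have e1 : q + u + p = p + q + u := by ring
    have e2 : u + q + p = p + q + u := by ring
    have e3 : q + p = p + q := by ring
    have e4 : u + p = p + u := by ring
    have e5 : u + q = q + u := by ring
    rw [e1, e3] at h2
    rw [e2, e4, e5] at h3
    linarith
  have h1 := add p p (q + q)
  have h2 := add q q p
  have e : ∀ q, (q + q) + p = p + (q + q) := fun q => by ring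
  rw [e, add_comm q p] at h2
  have h3 : δ (p + p + (q + q)) (q + q) = 2 ^ h * δ (p + q) q := by
    rw [← hδ.homog 2 two_pos]; congr 1 <;> ring
  have h4 : δ (p + p + (q + q)) (p + p) = 2 ^ h * δ (p + q) p := by
    rw [← hδ.homog 2 two_pos]; congr 1 <;> ring
  have h5 : (2 : ℝ) ^ h < 4 := by
    calc (2 : ℝ) ^ h < 2 ^ (2 : ℝ) := Real.rpow_lt_rpow_of_exponent_lt (by norm_num) hh
      _ = 4 := by norm_num
  have h6 : (4 - (2 : ℝ) ^ h) * (δ (p + q) q - δ (p + q) p) = 0 := by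
    rw [h3, h4] at h1; linarith
  rcases mul_eq_zero.1 h6 with h7 | h7 <;> linarith

/-- The total of the gap form over a merging of the four gaps `a, b, c, d` into one does not depend
on the order in which they are merged. -/
lemma gap_four (hδ : IsHomogCocycle h δ) (hh : h < 2) (a b c d : ℝ) :
    δ (a + b + (c + d)) (c + d) + δ (a + b) b + δ (c + d) d =
      δ (a + c + (b + d)) (b + d) + δ (a + c) c + δ (b + d) d := by
  have key : ∀ a b v, δ (a + b + v) v + δ (a + b) b = δ (a + (b + v)) (b + v) + δ (b + v) v := by
    intro a b v
    have h1 := hδ.gap_cocycle b a v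
    rw [add_comm b a] at h1
    rw [← add_assoc a b v]
    linarith
  have h1 := key a b (c + d)
  have h2 := key a c (b + d)
  have h3 := key b c d
  have h4 := key c b d
  have e1 : c + (b + d) = b + (c + d) := by ring
  have e2 : c + b = b + c := by ring
  rw [e1] at h2 h4
  rw [e2, ← hδ.gap_symm hh b c] at h4
  linarith

lemma gap_self (hδ : IsHomogCocycle h δ) (h21 : δ 2 1 = 0) (p : ℝ) : δ (p + p) p = 0 := by
  have pos : ∀ p, 0 < p → δ (p + p) p = 0 := by
    intro p hp
    have := hδ.homog p hp 2 1
    rw [h21, mul_zero, mul_one, mul_two] at this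
    exact this
  rcases lt_trichotomy p 0 with hp | rfl | hp
  · have h1 := pos (-p) (by linarith)
    rw [hδ.apply_rotate, add_sub_cancel_right, hδ.apply_rotate, hδ.anti]
    have e : -p - p = -p + -p := by ring
    rw [e, h1, neg_zero]
  · exact hδ.apply_zero_right _
  · exact pos p hp

/-- For `h ≠ 1`, a homogeneous cocycle is determined by its value at `(2, 1)`: merging the gaps
`p, p, q, q` in two ways shows that the gap form `G` satisfies `G (2 p) (2 q) = 2 G p q`, while it
is homogeneous of degree `h`. -/
lemma eq_zero_of_ne_one (hδ : IsHomogCocycle h δ) (hh : h < 2) (h1 : h ≠ 1) (h21 : δ 2 1 = 0)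
    (x y : ℝ) : δ x y = 0 := by
  have h3 := hδ.gap_four hh (x - y) (x - y) y y
  have h4 := hδ.gap_self h21
  rw [h4, h4, h4, sub_add_cancel] at h3
  have h5 : δ (x - y + (x - y) + (y + y)) (y + y) = 2 ^ h * δ x y := by
    rw [← hδ.homog 2 two_pos]; congr 1 <;> ring
  rw [h5] at h3
  have h6 : (2 : ℝ) ^ h ≠ 2 := by
    intro h7
    exact h1 ((Real.rpow_right_inj (by norm_num) (by norm_num)).1
      (h7.trans (Real.rpow_one 2).symm))
  have h7 : ((2 : ℝ) ^ h - 2) * δ x y = 0 := by linarith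
  exact (mul_eq_zero.1 h7).resolve_left (sub_ne_zero.2 h6)

/-- The maximum of `r ↦ δ 1 r` on `[0, 1]` is nonpositive. Multiplying the distribution
`(r, 1 - r)` with itself and regrouping the four masses bounds twice the value at the maximum by
`1 + r ^ 2 + (1 - r) ^ 2 < 2` times this value. -/
lemma apply_one_nonpos (hδ : IsHomogCocycle 1 δ) (hc : Continuous (δ 1)) (h21 : δ 2 1 = 0)
    {r : ℝ} (hr : r ∈ Set.Icc (0 : ℝ) 1) : δ 1 r ≤ 0 := by
  obtain ⟨r₀, hr₀, hmax⟩ :=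
    isCompact_Icc.exists_isMaxOn (Set.nonempty_Icc.2 (zero_le_one' ℝ)) hc.continuousOn
  refine (hmax hr).trans ?_
  change δ 1 r₀ ≤ 0
  rcases hr₀.1.eq_or_lt with h0 | h0
  · rw [← h0, hδ.apply_zero_right]
  rcases hr₀.2.eq_or_lt with h1 | h1
  · rw [h1, hδ.self_eq_zero]
  set p := 1 - r₀ with hp
  have hp0 : 0 < p := by linarith
  -- the masses of `(p, r₀)` times itself, paired by the first factor on the left-hand side, and
  -- `p * p` with `r₀ * r₀` and the two equal masses with each other on the right-hand side
  have four := hδ.gap_four (by norm_num) (p * p) (p * r₀) (r₀ * r₀) (r₀ * p)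
  have symm := hδ.gap_symm (by norm_num) p r₀
  have hom : ∀ l, 0 < l → ∀ x, δ l (l * x) = l * δ 1 x := by
    intro l hl x
    simpa using hδ.homog l hl 1 x
  have e1 : p * p + p * r₀ = p := by rw [hp]; ring
  have e2 : r₀ * r₀ + r₀ * p = r₀ := by rw [hp]; ring
  have e3 : p + r₀ = 1 := by rw [hp]; ring
  have e4 : p * p + r₀ * r₀ + (p * r₀ + r₀ * p) = 1 := by rw [hp]; ring
  set m := p * p + r₀ * r₀ with hm
  have hm0 : 0 < m := by positivity
  have hq0 : 0 < p * r₀ := by positivity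
  have hm1 : m < 1 := by linarith [mul_comm r₀ p]
  have e5 : δ m (r₀ * r₀) = m * δ 1 (r₀ * r₀ / m) := by
    rw [← hom m hm0, mul_div_cancel₀ _ hm0.ne']
  rw [e1, e2, e3, e4, hom _ h0, hom _ hp0, e5, mul_comm r₀ p, hδ.gap_self h21] at four
  rw [e3] at symm
  rw [← symm] at four
  have b1 : δ 1 (p * r₀ + p * r₀) ≤ δ 1 r₀ :=
    hmax ⟨by positivity, by linarith [mul_comm r₀ p]⟩
  have b2 : δ 1 (r₀ * r₀ / m) ≤ δ 1 r₀ :=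
    hmax ⟨by positivity, (div_le_one hm0).2 (by nlinarith)⟩
  have b3 : m * δ 1 (r₀ * r₀ / m) ≤ m * δ 1 r₀ := by gcongr
  have b4 : (1 - m) * δ 1 r₀ ≤ 0 := by
    have : p * δ 1 r₀ + r₀ * δ 1 r₀ = δ 1 r₀ := by rw [← add_mul, e3, one_mul]
    linarith
  by_contra hcon
  have := mul_pos (sub_pos.2 hm1) (not_le.1 hcon)
  linarith

/-- For `h = 1`, a continuous homogeneous cocycle is determined by its value at `(2, 1)`. -/
lemma eq_zero_of_continuous (hδ : IsHomogCocycle 1 δ) (hc : Continuous (δ 1)) (h21 : δ 2 1 = 0)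
    (x y : ℝ) : δ x y = 0 := by
  have unit : ∀ r ∈ Set.Icc (0 : ℝ) 1, δ 1 r = 0 := by
    intro r hr
    refine le_antisymm (hδ.apply_one_nonpos hc h21 hr) ?_
    have := hδ.neg.apply_one_nonpos hc.neg (by simp [h21]) hr
    linarith
  have lower : ∀ x y, 0 < x → 0 ≤ y → y ≤ x → δ x y = 0 := by
    intro x y hx hy hyx
    have := hδ.homog x hx 1 (y / x)
    rwa [mul_one, mul_div_cancel₀ _ hx.ne',
      unit _ ⟨by positivity, (div_le_one hx).2 hyx⟩, mul_zero] at this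
  have pos : ∀ x y, 0 < x → 0 < y → δ x y = 0 := by
    intro x y hx hy
    rcases le_total y x with h | h
    · exact lower x y hx hy.le h
    · rw [hδ.anti, lower y x hy hx.le h, neg_zero]
  have posneg : ∀ x y, 0 < x → y < 0 → δ x y = 0 := fun x y hx hy => by
    rw [hδ.apply_rotate]
    exact pos _ _ (by linarith) (by linarith)
  rcases lt_trichotomy x 0 with hx | rfl | hx
  · rcases lt_trichotomy y 0 with hy | rfl | hy
    · rw [hδ.apply_rotate]
      rcases lt_trichotomy (x - y) 0 with h | h | h
      · exact posneg _ _ (by linarith) h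
      · rw [h, hδ.apply_zero_right]
      · exact pos _ _ (by linarith) h
    · exact hδ.apply_zero_right x
    · rw [hδ.anti, posneg y x hy hx, neg_zero]
  · rw [hδ.anti, hδ.apply_zero_right, neg_zero]
  · rcases lt_trichotomy y 0 with hy | rfl | hy
    · exact posneg x y hx hy
    · exact hδ.apply_zero_right x
    · exact pos x y hx hy

end IsHomogCocycle

/-! ### The kernel of the cross-covariance -/

/-- The odd function that carries the asymmetric part of the cross-covariance of a multivariate
fractional Brownian motion with `H_i + H_j = h`. -/
noncomputable def oddKernel (h x : ℝ) : ℝ :=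
  if h = 1 then x * Real.log |x| else -(sgn x * |x| ^ h)

/-- The function `C` for which the cross-covariance of a multivariate fractional Brownian motion
is `Cov (B^i_t, B^j_s) = (C (-t) + C s - C (s - t)) / 2`. -/
noncomputable def crossKernel (h r e x : ℝ) : ℝ := r * |x| ^ h + e * oddKernel h x

lemma sgn_neg {x : ℝ} (hx : x ≠ 0) : sgn (-x) = -sgn x := by
  unfold sgn
  rcases lt_or_gt_of_ne hx with h | h
  · rw [if_pos (by linarith), if_neg (by linarith), neg_neg]
  · rw [if_neg (by linarith), if_pos h.le]

lemma sgn_mul_of_pos {l : ℝ} (hl : 0 < l) (x : ℝ) : sgn (l * x) = sgn x := by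
  simp only [sgn, mul_nonneg_iff_of_pos_left hl]

lemma abs_sgn (x : ℝ) : |sgn x| = 1 := by
  unfold sgn; split_ifs <;> simp

lemma oddKernel_neg {h : ℝ} (hh : 0 < h) (x : ℝ) : oddKernel h (-x) = -oddKernel h x := by
  rcases eq_or_ne x 0 with rfl | hx
  · simp [oddKernel, Real.zero_rpow hh.ne']
  · unfold oddKernel
    split_ifs
    · rw [abs_neg]; ring
    · rw [abs_neg, sgn_neg hx]; ring

lemma mfbmCrossCov_eq_crossKernel {h : ℝ} (hh : 0 < h) (r e t s : ℝ) :
    mfbmCrossCov h r e t s =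
      (1 / 2) * (crossKernel h r e (-t) + crossKernel h r e s - crossKernel h r e (s - t)) := by
  simp only [crossKernel, oddKernel_neg hh]
  unfold mfbmCrossCov oddKernel
  split_ifs with h1
  · simp only [abs_neg, h1, Real.rpow_one]; ring
  · simp only [abs_neg]; ring

lemma isHomogCocycle_oddKernel {h : ℝ} (hh : 0 < h) :
    IsHomogCocycle h (fun x y => oddKernel h y - oddKernel h x - oddKernel h (y - x)) where
  anti x y := by rw [← neg_sub y x, oddKernel_neg hh]; ring
  cocycle x y u := by
    rw [sub_sub_sub_cancel_right, ← neg_sub u y, oddKernel_neg hh]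
    ring
  homog l hl x y := by
    unfold oddKernel
    rw [← mul_sub]
    split_ifs with h1
    · subst h1
      have key : ∀ z, l * z * Real.log |l * z| = l * (z * Real.log |z|) + l * Real.log l * z := by
        intro z
        rcases eq_or_ne z 0 with rfl | hz
        · simp
        · rw [abs_mul, abs_of_pos hl, Real.log_mul hl.ne' (abs_ne_zero.2 hz)]; ring
      rw [key, key, key, Real.rpow_one]
      ring
    · have key : ∀ z, sgn (l * z) * |l * z| ^ h = l ^ h * (sgn z * |z| ^ h) := by
        intro z
        rw [sgn_mul_of_pos hl, abs_mul, abs_of_pos hl, Real.mul_rpow hl.le (abs_nonneg _)]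
        ring
      rw [key, key, key]
      ring

/-- The value at `(2, 1)` of the cocycle of `oddKernel h` does not vanish. -/
lemma oddKernel_two_one_ne_zero {h : ℝ} (hh : 0 < h) :
    oddKernel h 1 - oddKernel h 2 - oddKernel h (1 - 2) ≠ 0 := by
  have e : (1 : ℝ) - 2 = -1 := by norm_num
  rw [e, oddKernel_neg hh]
  unfold oddKernel
  split_ifs with h1
  · have := Real.log_pos (one_lt_two)
    simp [this.ne']
  · simp only [sgn, zero_le_one, zero_le_two, if_true, abs_one, abs_two, Real.one_rpow, one_mul]
    intro h2
    have h3 : (2 : ℝ) ^ h = 2 ^ (1 : ℝ) := by rw [Real.rpow_one]; linarith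
    exact h1 ((Real.rpow_right_inj (by norm_num) (by norm_num)).1 h3)

lemma continuous_oddKernel {h : ℝ} (hh : 0 < h) : Continuous (oddKernel h) := by
  unfold oddKernel
  split_ifs
  · simpa only [Real.log_abs] using Real.continuous_mul_log
  · have hc : Continuous fun x : ℝ => |x| ^ h :=
      continuous_abs.rpow_const fun _ => Or.inr hh.le
    have e : (fun x : ℝ => -(sgn x * |x| ^ h)) =
        fun x => if 0 ≤ x then -|x| ^ h else |x| ^ h := by
      ext x; unfold sgn; split_ifs <;> ring
    rw [e]
    refine Continuous.if_le hc.neg hc continuous_const continuous_id fun x hx => ?_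
    simp [← hx, Real.zero_rpow hh.ne']

/-! ### Existence of the cross-correlation parameters -/

section Covariance

variable {Ω : Type*} [MeasurableSpace Ω] {P : Measure Ω}

/-- The Cauchy-Schwarz inequality for covariances. -/
lemma sq_covariance_le [IsProbabilityMeasure P] {X Z : Ω → ℝ} (hX : MemLp X 2 P)
    (hZ : MemLp Z 2 P) : covariance X Z P ^ 2 ≤ variance X P * variance Z P := by
  -- the variance of `c • X + Z`, a quadratic polynomial in `c`
  have key : ∀ c : ℝ, 0 ≤ variance X P * (c * c) + (2 * covariance X Z P) * c + variance Z P := by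
    intro c
    have h1 := variance_nonneg (c • X + Z) P
    rw [variance_add (hX.const_smul c) hZ, variance_smul, covariance_smul_left] at h1
    linarith
  have := discrim_le_zero key
  rw [discrim] at this
  linarith

lemma covariance_eq_zero_of_variance_eq_zero [IsProbabilityMeasure P] {X Z : Ω → ℝ}
    (hX : MemLp X 2 P) (hZ : MemLp Z 2 P) (h : variance X P = 0) : covariance X Z P = 0 := by
  have := sq_covariance_le hX hZ
  rw [h, zero_mul] at this
  exact pow_eq_zero_iff two_ne_zero |>.1 (le_antisymm this (sq_nonneg _))

namespace IsFBM

variable {h : ℝ} {X : ℝ → Ω → ℝ}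

lemma memLp (hX : IsFBM h X P) (t : ℝ) : MemLp (X t) 2 P :=
  (hX.gaussian.hasGaussianLaw_eval t).memLp_two

lemma aemeasurable (hX : IsFBM h X P) (t : ℝ) : AEMeasurable (X t) P :=
  hX.gaussian.aemeasurable t

lemma variance_eq (hX : IsFBM h X P) (hh : 0 < h) (t : ℝ) : variance (X t) P = |t| ^ (2 * h) := by
  rw [← covariance_self (hX.aemeasurable t), hX.covariance_eq, sub_self, abs_zero,
    Real.zero_rpow (by positivity)]
  ring

lemma variance_sub_eq (hX : IsFBM h X P) (hh : 0 < h) (t s : ℝ) :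
    variance (X t - X s) P = |t - s| ^ (2 * h) := by
  have := hX.gaussian.isProbabilityMeasure
  rw [variance_sub (hX.memLp t) (hX.memLp s), hX.variance_eq hh, hX.variance_eq hh,
    hX.covariance_eq]
  ring

lemma integral_sq_sub (hX : IsFBM h X P) (hh : 0 < h) (t s : ℝ) :
    ∫ ω, (X t ω - X s ω) ^ 2 ∂P = |t - s| ^ (2 * h) := by
  have := hX.gaussian.isProbabilityMeasure
  rw [← hX.variance_sub_eq hh, variance_of_integral_eq_zero]
  · rfl
  · exact ((hX.memLp t).sub (hX.memLp s)).aestronglyMeasurable.aemeasurable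
  · simp only [Pi.sub_apply]
    rw [integral_sub ((hX.memLp t).integrable (by norm_num))
      ((hX.memLp s).integrable (by norm_num)), hX.centered, hX.centered, sub_zero]

/-- The covariance of a square-integrable variable with a fractional Brownian motion depends
continuously on the time. -/
lemma continuous_covariance (hX : IsFBM h X P) (hh : 0 < h) {Z : Ω → ℝ} (hZ : MemLp Z 2 P) :
    Continuous fun t => covariance Z (X t) P := by
  have := hX.gaussian.isProbabilityMeasure
  refine continuous_iff_continuousAt.2 fun t => ?_
  rw [ContinuousAt, tendsto_iff_norm_sub_tendsto_zero]
  have lim : Tendsto (fun s => Real.sqrt (variance Z P * |s - t| ^ (2 * h))) (𝓝 t) (𝓝 0) := by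
    have hc : Continuous fun s => Real.sqrt (variance Z P * |s - t| ^ (2 * h)) :=
      (continuous_const.mul (((continuous_id.sub continuous_const).abs).rpow_const
        fun _ => Or.inr (by positivity))).sqrt
    have := hc.tendsto t
    simpa [Real.zero_rpow (by positivity : 2 * h ≠ 0)] using this
  refine squeeze_zero (fun _ => norm_nonneg _) (fun s => ?_) lim
  rw [← covariance_sub_right hZ (hX.memLp s) (hX.memLp t), Real.norm_eq_abs,
    ← hX.variance_sub_eq hh]
  exact Real.abs_le_sqrt (sq_covariance_le hZ ((hX.memLp s).sub (hX.memLp t)))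

end IsFBM

namespace IsMFBM

variable {d : ℕ} {H : Fin d → ℝ} {B : Fin d → ℝ → Ω → ℝ}

lemma covariance_eq_integral (hB : IsMFBM H B P) (i j : Fin d) (t s : ℝ) :
    covariance (B i t) (B j s) P = ∫ ω, B i t ω * B j s ω ∂P := by
  simp [covariance, (hB.component i).centered, (hB.component j).centered]

lemma covariance_zero_left (hB : IsMFBM H B P) (hH : ∀ i, 0 < H i) (i j : Fin d) (s : ℝ) :
    covariance (B i 0) (B j s) P = 0 := by
  have := hB.gaussian.isProbabilityMeasure
  refine covariance_eq_zero_of_variance_eq_zero ((hB.component i).memLp 0)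
    ((hB.component j).memLp s) ?_
  rw [(hB.component i).variance_eq (hH i), abs_zero,
    Real.zero_rpow (mul_pos two_pos (hH i)).ne']

lemma covariance_zero_right (hB : IsMFBM H B P) (hH : ∀ i, 0 < H i) (i j : Fin d) (t : ℝ) :
    covariance (B i t) (B j 0) P = 0 := by
  rw [covariance_comm, hB.covariance_zero_left hH]

lemma covariance_mul (hB : IsMFBM H B P) (i j : Fin d) {l : ℝ} (hl : 0 < l) (t s : ℝ) :
    covariance (B i (l * t)) (B j (l * s)) P =
      l ^ (H i + H j) * covariance (B i t) (B j s) P := by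
  classical
  have ht : t ∈ ({t, s} : Finset ℝ) := by simp
  have hs : s ∈ ({t, s} : Finset ℝ) := by simp
  have hm : Measurable fun f : ({t, s} : Finset ℝ) → Fin d → ℝ => f ⟨t, ht⟩ i * f ⟨s, hs⟩ j := by
    fun_prop
  have := ((hB.self_similar l hl {t, s}).comp hm).integral_eq
  simp only [Function.comp_def] at this
  rw [hB.covariance_eq_integral, hB.covariance_eq_integral, this, ← integral_const_mul,
    Real.rpow_add hl]
  congr 1; ext ω; ring

lemma covariance_increments (hB : IsMFBM H B P) (hH : ∀ i, 0 < H i) (i j : Fin d) (t s u : ℝ) :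
    covariance (B i (t + u)) (B j (s + u)) P - covariance (B i (t + u)) (B j u) P -
      covariance (B i u) (B j (s + u)) P + covariance (B i u) (B j u) P =
    covariance (B i t) (B j s) P := by
  classical
  have := hB.gaussian.isProbabilityMeasure
  have ht : t ∈ ({t, s} : Finset ℝ) := by simp
  have hs : s ∈ ({t, s} : Finset ℝ) := by simp
  have hm : Measurable fun f : ({t, s} : Finset ℝ) → Fin d → ℝ => f ⟨t, ht⟩ i * f ⟨s, hs⟩ j := by
    fun_prop
  have h1 := ((hB.stationary_increments u {t, s}).comp hm).integral_eq
  simp only [Function.comp_def] at h1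
  have mem : ∀ k r, MemLp (B k r) 2 P := fun k r => (hB.component k).memLp r
  have h2 : ∀ x y z w, covariance (B i x) (B j z) P - covariance (B i x) (B j w) P -
      covariance (B i y) (B j z) P + covariance (B i y) (B j w) P =
      ∫ ω, (B i x ω - B i y ω) * (B j z ω - B j w ω) ∂P := by
    intro x y z w
    have int : ∀ k r, Integrable (B k r) P := fun k r => (mem k r).integrable (by norm_num)
    rw [← covariance_fun_sub_fun_sub (mem i x) (mem i y) (mem j z) (mem j w), covariance,
      integral_sub (int i x) (int i y), integral_sub (int j z) (int j w)]
    simp [(hB.component i).centered, (hB.component j).centered]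
  rw [h2, h1, ← h2, hB.covariance_zero_right hH, hB.covariance_zero_left hH,
    hB.covariance_zero_left hH]
  ring

lemma covariance_self_time (hB : IsMFBM H B P) (hH : ∀ i, 0 < H i) (i j : Fin d) (t : ℝ) :
    covariance (B i t) (B j t) P = |t| ^ (H i + H j) * covariance (B i 1) (B j 1) P := by
  have pos : ∀ t, 0 < t → covariance (B i t) (B j t) P =
      |t| ^ (H i + H j) * covariance (B i 1) (B j 1) P := by
    intro t ht
    rw [abs_of_pos ht, ← hB.covariance_mul i j ht, mul_one]
  rcases lt_trichotomy t 0 with ht | rfl | ht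
  · -- stationarity, with the increments over `[t, 0]` and over `[0, -t]`
    have h1 := hB.covariance_increments hH i j (-t) (-t) t
    rw [neg_add_cancel, hB.covariance_zero_right hH, hB.covariance_zero_left hH,
      hB.covariance_zero_right hH, pos (-t) (by linarith), abs_neg] at h1
    linarith
  · rw [hB.covariance_zero_left hH, abs_zero, Real.zero_rpow (add_pos (hH i) (hH j)).ne', zero_mul]
  · exact pos t ht

lemma covariance_add_covariance_swap (hB : IsMFBM H B P) (hH : ∀ i, 0 < H i) (i j : Fin d)
    (t s : ℝ) :
    covariance (B i t) (B j s) P + covariance (B i s) (B j t) P =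
      covariance (B i 1) (B j 1) P *
        (|t| ^ (H i + H j) + |s| ^ (H i + H j) - |s - t| ^ (H i + H j)) := by
  have h1 := hB.covariance_increments hH i j (t - s) (t - s) s
  rw [sub_add_cancel, hB.covariance_self_time hH i j t, hB.covariance_self_time hH i j s,
    hB.covariance_self_time hH i j (t - s), abs_sub_comm t s] at h1
  linarith

lemma isHomogCocycle (hB : IsMFBM H B P) (hH : ∀ i, 0 < H i) (i j : Fin d) :
    IsHomogCocycle (H i + H j)
      (fun x y => covariance (B i x) (B j y) P - covariance (B i y) (B j x) P) where
  anti x y := by ring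
  cocycle x y u := by
    have h1 := hB.covariance_increments hH i j (x - u) (y - u) u
    have h2 := hB.covariance_increments hH i j (y - u) (x - u) u
    rw [sub_add_cancel, sub_add_cancel] at h1 h2
    linarith
  homog l hl x y := by rw [hB.covariance_mul i j hl, hB.covariance_mul i j hl]; ring

/-- The antisymmetric part of the cross-covariance is a multiple of the cocycle of `oddKernel`:
both are homogeneous cocycles, and these are determined by one value. -/
lemma covariance_sub_covariance_swap (hB : IsMFBM H B P) (hH : ∀ i, 0 < H i ∧ H i < 1)
    (i j : Fin d) (t s : ℝ) :
    covariance (B i t) (B j s) P - covariance (B i s) (B j t) P =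
      (covariance (B i 2) (B j 1) P - covariance (B i 1) (B j 2) P) /
        (oddKernel (H i + H j) 1 - oddKernel (H i + H j) 2 - oddKernel (H i + H j) (1 - 2)) *
      (oddKernel (H i + H j) s - oddKernel (H i + H j) t - oddKernel (H i + H j) (s - t)) := by
  have hH0 : ∀ i, 0 < H i := fun i => (hH i).1
  have hh : 0 < H i + H j := add_pos (hH0 i) (hH0 j)
  set c := (covariance (B i 2) (B j 1) P - covariance (B i 1) (B j 2) P) /
        (oddKernel (H i + H j) 1 - oddKernel (H i + H j) 2 - oddKernel (H i + H j) (1 - 2)) with hc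
  have hδ := (hB.isHomogCocycle hH0 i j).sub ((isHomogCocycle_oddKernel hh).const_mul c)
  have h21 : (covariance (B i 2) (B j 1) P - covariance (B i 1) (B j 2) P) -
      c * (oddKernel (H i + H j) 1 - oddKernel (H i + H j) 2 - oddKernel (H i + H j) (1 - 2)) =
      0 := by
    rw [hc, div_mul_cancel₀ _ (oddKernel_two_one_ne_zero hh), sub_self]
  refine sub_eq_zero.1 ?_
  by_cases h1 : H i + H j = 1
  · rw [h1] at hδ h21 ⊢
    refine hδ.eq_zero_of_continuous ?_ h21 t s
    have c1 := (hB.component j).continuous_covariance (hH0 j) ((hB.component i).memLp 1)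
    have c2 := (hB.component i).continuous_covariance (hH0 i) ((hB.component j).memLp 1)
    simp only [covariance_comm (B j 1)] at c2
    have c3 := continuous_oddKernel zero_lt_one
    fun_prop
  · exact hδ.eq_zero_of_ne_one (by linarith [(hH i).2, (hH j).2]) h1 h21 t s

/-- The cross-covariance is half the sum of its symmetric and its antisymmetric part. -/
lemma exists_isCrossParam (hB : IsMFBM H B P) (hH : ∀ i, 0 < H i ∧ H i < 1) :
    ∃ ρ η : Fin d → Fin d → ℝ, IsCrossParam H B P ρ η := by
  have hH0 : ∀ i, 0 < H i := fun i => (hH i).1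
  refine ⟨fun i j => covariance (B i 1) (B j 1) P,
    fun i j => (covariance (B i 2) (B j 1) P - covariance (B i 1) (B j 2) P) /
      (oddKernel (H i + H j) 1 - oddKernel (H i + H j) 2 - oddKernel (H i + H j) (1 - 2)),
    fun i j _ => covariance_comm _ _, fun i j _ => ?_, fun i j _ => ?_, fun i j _ t s => ?_⟩
  · rw [covariance_comm (B j 2), covariance_comm (B j 1), add_comm (H j), ← neg_div, neg_sub]
  · simp [(hB.component _).variance_eq (hH0 _)]
  · have hh : 0 < H i + H j := add_pos (hH0 i) (hH0 j)
    have h1 := hB.covariance_add_covariance_swap hH0 i j t s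
    have h2 := hB.covariance_sub_covariance_swap hH i j t s
    rw [mfbmCrossCov_eq_crossKernel hh]
    simp only [crossKernel, oddKernel_neg hh, abs_neg]
    linarith

end IsMFBM

end Covariance

/-! ### Integrals against the exponential distribution -/

lemma expMeasure_eq_withDensity {a : ℝ} :
    expMeasure a = (volume.restrict (Set.Ioi 0)).withDensity
      (fun x => ENNReal.ofReal (a * Real.exp (-(a * x)))) := by
  have e : (exponentialPDF a) =ᵐ[volume]
      (Set.Ioi 0).indicator (fun x => ENNReal.ofReal (a * Real.exp (-(a * x)))) := by
    have : ∀ᵐ x : ℝ, x ≠ 0 := by simp [ae_iff, measure_singleton]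
    filter_upwards [this] with x hx
    rw [exponentialPDF_eq]
    rcases lt_or_gt_of_ne hx with h | h
    · simp [h.not_ge, h.le]
    · simp [h, h.le]
  calc expMeasure a = volume.withDensity (exponentialPDF a) := rfl
    _ = _ := by rw [withDensity_congr_ae e, withDensity_indicator measurableSet_Ioi]

lemma integral_expMeasure {a : ℝ} (ha : 0 < a) (f : ℝ → ℝ) :
    ∫ x, f x ∂(expMeasure a) = ∫ x in Set.Ioi 0, a * Real.exp (-(a * x)) * f x := by
  rw [expMeasure_eq_withDensity, integral_withDensity_eq_integral_toReal_smul (by fun_prop)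
    (by simp)]
  refine integral_congr_ae (Eventually.of_forall fun x => ?_)
  simp only [smul_eq_mul]
  rw [ENNReal.toReal_ofReal (by positivity)]

lemma integrable_expMeasure_iff {a : ℝ} (ha : 0 < a) (f : ℝ → ℝ) :
    Integrable f (expMeasure a) ↔
      IntegrableOn (fun x => Real.exp (-(a * x)) * f x) (Set.Ioi 0) := by
  rw [expMeasure_eq_withDensity, integrable_withDensity_iff_integrable_smul' (by fun_prop)
    (by simp), IntegrableOn]
  have e : (fun x => (ENNReal.ofReal (a * Real.exp (-(a * x)))).toReal • f x) =
      fun x => a * (Real.exp (-(a * x)) * f x) := by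
    ext x
    rw [ENNReal.toReal_ofReal (by positivity), smul_eq_mul]; ring
  rw [e]
  exact integrable_const_mul_iff (isUnit_iff_ne_zero.2 ha.ne') _

lemma integrable_rpow_expMeasure {a : ℝ} (ha : 0 < a) {p : ℝ} (hp : 0 ≤ p) :
    Integrable (fun x => |x| ^ p) (expMeasure a) := by
  rw [integrable_expMeasure_iff ha]
  have h := integrableOn_rpow_mul_exp_neg_mul_rpow (s := p) (p := 1) (b := a)
    (by linarith) one_pos ha
  refine h.congr_fun (fun x hx => ?_) measurableSet_Ioi
  simp only [Set.mem_Ioi] at hx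
  simp only [Real.rpow_one, abs_of_pos hx, neg_mul]
  ring

/-! ### The pathwise integral -/

/-- Integration by parts for a Riemann-Stieltjes integral with a differentiable integrand. -/
lemma HasRSIntegral.eq_by_parts {f f' g : ℝ → ℝ} {a b J : ℝ} (hab : a ≤ b)
    (hf : ∀ x, HasDerivAt f (f' x) x) (hf' : Continuous f') (hg : Continuous g)
    (hJ : HasRSIntegral f g a b J) :
    J = f b * g b - f a * g a - ∫ x in a..b, f' x * g x := by
  set R := f b * g b - f a * g a - ∫ x in a..b, f' x * g x with hR
  set V := ∫ x in a..b, |f' x| with hV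
  have hV0 : 0 ≤ V := intervalIntegral.integral_nonneg hab fun x _ => abs_nonneg _
  have int : ∀ {u : ℝ → ℝ}, Continuous u → ∀ c d, IntervalIntegrable u volume c d :=
    fun hu c d => hu.intervalIntegrable c d
  have key : ∀ ε > 0, |J - R| ≤ ε * (1 + V) := by
    intro ε hε
    obtain ⟨δ, hδ, hsum⟩ := hJ ε hε
    have huc : UniformContinuousOn g (Set.Icc a b) :=
      isCompact_Icc.uniformContinuousOn_of_continuous hg.continuousOn
    obtain ⟨δ', hδ', hosc⟩ := Metric.uniformContinuousOn_iff.1 huc ε hε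
    obtain ⟨n, hn⟩ := exists_nat_gt ((b - a) / min δ δ')
    have hmin : 0 < min δ δ' := lt_min hδ hδ'
    have hn0 : (0 : ℝ) < n := lt_of_le_of_lt (div_nonneg (by linarith) hmin.le) hn
    set w := (b - a) / n with hw
    have hw0 : 0 ≤ w := div_nonneg (by linarith) hn0.le
    have hwlt : w < min δ δ' := by
      rw [hw, div_lt_iff₀ hn0, mul_comm, ← div_lt_iff₀ hmin]; exact hn
    set x : ℕ → ℝ := fun k => a + k * w with hx
    have hx0 : x 0 = a := by simp [hx]
    have hxn : x n = b := by simp only [hx, hw]; field_simp; ring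
    have hstep : ∀ k, x (k + 1) = x k + w := fun k => by simp only [hx]; push_cast; ring
    have hmono : Monotone x := monotone_nat_of_le_succ fun k => by rw [hstep]; linarith
    have h1 := hsum n x x hx0 hxn fun k _ =>
      ⟨le_rfl, by rw [hstep]; linarith, by rw [hstep, add_sub_cancel_left]
                                           exact hwlt.trans_le (min_le_left _ _)⟩
    -- summation by parts
    have h2 : ∑ k ∈ Finset.range n, f (x k) * (g (x (k + 1)) - g (x k)) - R =
        -∑ k ∈ Finset.range n, ∫ y in x k..x (k + 1), f' y * (g (x (k + 1)) - g y) := by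
      have e1 := Finset.sum_range_sub (fun k => f (x k) * g (x k)) n
      have e2 := intervalIntegral.sum_integral_adjacent_intervals (n := n) (a := x)
        (f := fun y => f' y * g y) (μ := volume) fun k _ => int (hf'.mul hg) _ _
      rw [hx0, hxn] at e1 e2
      rw [hR, ← e1, ← e2, ← Finset.sum_sub_distrib, ← Finset.sum_sub_distrib,
        ← Finset.sum_neg_distrib]
      refine Finset.sum_congr rfl fun k _ => ?_
      have e3 : ∫ y in x k..x (k + 1), f' y = f (x (k + 1)) - f (x k) :=
        intervalIntegral.integral_eq_sub_of_hasDerivAt (fun y _ => hf y) (int hf' _ _)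
      simp only [mul_sub]
      have e4 := intervalIntegral.integral_sub
        (int (hf'.mul (continuous_const (y := g (x (k + 1))))) (x k) (x (k + 1)))
        (int (hf'.mul hg) (x k) (x (k + 1)))
      simp only [Pi.mul_apply, intervalIntegral.integral_mul_const, e3] at e4
      rw [e4]
      ring
    have h3 : |∑ k ∈ Finset.range n, ∫ y in x k..x (k + 1), f' y * (g (x (k + 1)) - g y)| ≤
        ε * V := by
      have e2 := intervalIntegral.sum_integral_adjacent_intervals (n := n) (a := x)
        (f := fun y => |f' y|) (μ := volume) fun k _ => int hf'.abs _ _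
      rw [hx0, hxn] at e2
      rw [hV, ← e2, Finset.mul_sum]
      refine (Finset.abs_sum_le_sum_abs _ _).trans (Finset.sum_le_sum fun k hk => ?_)
      have hle : x k ≤ x (k + 1) := hmono k.le_succ
      have hlo : a ≤ x k := hx0 ▸ hmono k.zero_le
      have hhi : x (k + 1) ≤ b := hxn ▸ hmono (Finset.mem_range.1 hk)
      rw [← intervalIntegral.integral_const_mul]
      refine (intervalIntegral.abs_integral_le_integral_abs hle).trans
        (intervalIntegral.integral_mono_on hle (int ?_ _ _) (int ?_ _ _) fun y hy => ?_)
      · fun_prop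
      · fun_prop
      · rw [abs_mul, mul_comm]
        gcongr
        refine (hosc _ ⟨hlo.trans hle, hhi⟩ y ⟨hlo.trans hy.1, hy.2.trans hhi⟩ ?_).le
        have : x (k + 1) - y ≤ w := by rw [hstep]; linarith [hy.1]
        rw [Real.dist_eq, abs_of_nonneg (by linarith [hy.2])]
        exact (this.trans_lt hwlt).trans_le (min_le_right _ _)
    rw [← abs_neg, ← h2] at h3
    calc |J - R| ≤ _ := abs_sub_le J
          (∑ k ∈ Finset.range n, f (x k) * (g (x (k + 1)) - g (x k))) R
      _ ≤ ε + ε * V := add_le_add (by rw [abs_sub_comm]; exact h1.le) h3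
      _ = ε * (1 + V) := by ring
  have h0 : |J - R| ≤ 0 := by
    refine le_of_forall_gt_imp_ge_of_dense fun c hc => ?_
    have := key (c / (1 + V)) (by positivity)
    rwa [div_mul_cancel₀ _ (by positivity)] at this
  exact sub_eq_zero.1 (abs_nonpos_iff.1 h0)

/-- The moving average representation of the pathwise integral. The boundary term at `-∞` of the
integration by parts converges and is integrable, so it tends to `0`. -/
lemma HasImproperRSIntegral.eq_integral_expMeasure {a t I : ℝ} (ha : 0 < a) {g : ℝ → ℝ}
    (hg : Continuous g) (hint : Integrable (fun x => g t - g (t - x)) (expMeasure a))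
    (hI : HasImproperRSIntegral (fun s => Real.exp (-(a * (t - s)))) g t I) :
    I = ∫ x, (g t - g (t - x)) ∂(expMeasure a) := by
  obtain ⟨J, hJ, hlim⟩ := hI
  have : IsProbabilityMeasure (expMeasure a) := isProbabilityMeasure_expMeasure ha
  have hint' : Integrable (fun x => g (t - x)) (expMeasure a) := by
    have := (integrable_const (g t)).sub hint
    simpa only [Pi.sub_def, sub_sub_cancel] using this
  rw [integral_sub (integrable_const _) hint', integral_const, probReal_univ, one_smul,
    integral_expMeasure ha]
  rw [integrable_expMeasure_iff ha] at hint'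
  have lim : Tendsto (fun A => ∫ x in (0 : ℝ)..A, a * Real.exp (-(a * x)) * g (t - x)) atTop
      (𝓝 (∫ x in Set.Ioi 0, a * Real.exp (-(a * x)) * g (t - x))) := by
    refine intervalIntegral_tendsto_integral_Ioi 0 ?_ tendsto_id
    simp only [mul_assoc]
    exact hint'.const_mul a
  have hlim' : Tendsto (fun A => J (t - A)) atTop (𝓝 I) :=
    hlim.comp (tendsto_atBot_add_const_left atTop t tendsto_neg_atTop_atBot)
  have hparts : ∀ A, 0 ≤ A → J (t - A) = g t - Real.exp (-(a * A)) * g (t - A) -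
      ∫ x in (0 : ℝ)..A, a * Real.exp (-(a * x)) * g (t - x) := by
    intro A hA
    have h1 := (hJ (t - A) (by linarith)).eq_by_parts (by linarith)
      (f' := fun s => a * Real.exp (-(a * (t - s)))) (fun s => ?_) (by fun_prop) hg
    · have h2 := intervalIntegral.integral_comp_sub_left (a := 0) (b := A)
        (fun s => a * Real.exp (-(a * (t - s))) * g s) t
      simp only [sub_sub_cancel, sub_zero] at h2
      rw [h1, h2]
      simp
    · have h : HasDerivAt (fun s => -(a * (t - s))) a s := by
        simpa only [mul_neg_one, neg_neg] using
          (((hasDerivAt_id' s).const_sub t).const_mul a).fun_neg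
      rw [mul_comm]
      exact h.exp
  have hbdry : Tendsto (fun A => Real.exp (-(a * A)) * g (t - A)) atTop
      (𝓝 (g t - I - ∫ x in Set.Ioi 0, a * Real.exp (-(a * x)) * g (t - x))) := by
    refine ((hlim'.const_sub (g t)).sub lim).congr' ?_
    filter_upwards [eventually_ge_atTop 0] with A hA
    rw [hparts A hA]; ring
  have hzero := IntegrableAtFilter.eq_zero_of_tendsto (μ := volume)
    ⟨Set.Ioi 0, Ioi_mem_atTop 0, hint'⟩ (fun s hs => ?_) hbdry
  · linarith
  · obtain ⟨c, hc⟩ := mem_atTop_sets.1 hs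
    exact measure_mono_top (fun x hx => hc x hx) Real.volume_Ici

/-! ### The covariance of moving averages -/

section MovingAverage

variable {Ω : Type*} [MeasurableSpace Ω] {P : Measure Ω}

/-- A process with almost surely continuous paths is jointly measurable up to a null set, as the
limit of its piecewise constant discretizations. -/
lemma aestronglyMeasurable_uncurry_of_continuous_paths [SFinite P] {X : ℝ → Ω → ℝ}
    (hm : ∀ t, AEMeasurable (X t) P) (hc : ∀ᵐ ω ∂P, Continuous fun t => X t ω)
    (κ : Measure ℝ) [SFinite κ] :
    AEStronglyMeasurable (fun p : ℝ × Ω => X p.1 p.2) (κ.prod P) := by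
  choose G hGm hG using hm
  set u : ℕ → ℝ → ℤ := fun n x => ⌊((n : ℝ) + 1) * x⌋ with hu
  have hum : ∀ n, Measurable (u n) := fun n => by fun_prop
  set F : ℕ → ℝ × Ω → ℝ := fun n p => G ((u n p.1 : ℝ) / (n + 1)) p.2 with hF
  have hFm : ∀ n, Measurable (F n) := by
    intro n
    have h1 : Measurable fun q : ℤ × Ω => G ((q.1 : ℝ) / (n + 1)) q.2 :=
      measurable_from_prod_countable_right fun k => hGm ((k : ℝ) / (n + 1))
    exact h1.comp (((hum n).comp measurable_fst).prodMk measurable_snd)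
  have hgood : ∀ᵐ ω ∂P, ∀ (n : ℕ) (k : ℤ), X ((k : ℝ) / (n + 1)) ω = G ((k : ℝ) / (n + 1)) ω :=
    ae_all_iff.2 fun n => ae_all_iff.2 fun k => hG _
  have hlim : ∀ᵐ ω ∂P, ∀ x, Tendsto (fun n => F n (x, ω)) atTop (𝓝 (X x ω)) := by
    filter_upwards [hgood, hc] with ω h1 h2 x
    simp only [hF, ← h1]
    refine (h2.tendsto x).comp ?_
    refine tendsto_iff_norm_sub_tendsto_zero.2 (squeeze_zero (fun _ => norm_nonneg _) (fun n => ?_)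
      (tendsto_one_div_add_atTop_nhds_zero_nat (𝕜 := ℝ)))
    have hn : (0 : ℝ) < n + 1 := by positivity
    have e : (u n x : ℝ) / (n + 1) - x = -(((n + 1) * x - u n x) / (n + 1)) := by field_simp; ring
    rw [Real.norm_eq_abs, e, abs_neg, abs_div, abs_of_pos hn,
      abs_of_nonneg (sub_nonneg.2 (Int.floor_le _))]
    gcongr
    linarith [Int.lt_floor_add_one (((n : ℝ) + 1) * x)]
  refine aestronglyMeasurable_of_tendsto_ae atTop (fun n => (hFm n).aestronglyMeasurable) ?_
  have := Measure.quasiMeasurePreserving_snd (μ := κ) (ν := P) |>.ae hlim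
  filter_upwards [this] with p hp using hp p.1

/-- Fubini for the product of two averages of square-integrable random functions. -/
lemma integral_integral_mul_integral [IsProbabilityMeasure P] {κ κ' : Measure ℝ}
    [IsProbabilityMeasure κ] [IsProbabilityMeasure κ'] {Z W : ℝ → Ω → ℝ} {u v : ℝ → ℝ}
    (hZm : AEStronglyMeasurable (fun p : ℝ × Ω => Z p.1 p.2) (κ.prod P))
    (hWm : AEStronglyMeasurable (fun p : ℝ × Ω => W p.1 p.2) (κ'.prod P))
    (hZ : ∀ x, MemLp (Z x) 2 P) (hW : ∀ x, MemLp (W x) 2 P)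
    (hu : ∀ x, ∫ ω, Z x ω ^ 2 ∂P = u x) (hv : ∀ x, ∫ ω, W x ω ^ 2 ∂P = v x)
    (hui : Integrable u κ) (hvi : Integrable v κ') :
    ∫ ω, (∫ x, Z x ω ∂κ) * (∫ y, W y ω ∂κ') ∂P =
      ∫ p : ℝ × ℝ, ∫ ω, Z p.1 ω * W p.2 ω ∂P ∂(κ.prod κ') := by
  have hm : AEStronglyMeasurable (fun q : (ℝ × ℝ) × Ω => Z q.1.1 q.2 * W q.1.2 q.2)
      ((κ.prod κ').prod P) := by
    have h1 : Measure.QuasiMeasurePreserving (fun q : (ℝ × ℝ) × Ω => (q.1.1, q.2))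
        ((κ.prod κ').prod P) (κ.prod P) := by
      exact (measurePreserving_fst.prod (MeasurePreserving.id P)).quasiMeasurePreserving
    have h2 : Measure.QuasiMeasurePreserving (fun q : (ℝ × ℝ) × Ω => (q.1.2, q.2))
        ((κ.prod κ').prod P) (κ'.prod P) := by
      exact (measurePreserving_snd.prod (MeasurePreserving.id P)).quasiMeasurePreserving
    exact (hZm.comp_quasiMeasurePreserving h1).mul (hWm.comp_quasiMeasurePreserving h2)
  have hint : Integrable (fun q : (ℝ × ℝ) × Ω => Z q.1.1 q.2 * W q.1.2 q.2)
      ((κ.prod κ').prod P) := by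
    refine (integrable_prod_iff hm).2
      ⟨Eventually.of_forall fun p => (hZ p.1).integrable_mul (hW p.2), ?_⟩
    refine Integrable.mono' ((hui.comp_fst κ').add (hvi.comp_snd κ)) hm.norm.integral_prod_right'
      (Eventually.of_forall fun p => ?_)
    rw [Real.norm_of_nonneg (integral_nonneg fun _ => norm_nonneg _)]
    simp only [Pi.add_apply]
    rw [← hu, ← hv, ← integral_add (hZ p.1).integrable_sq (hW p.2).integrable_sq]
    refine integral_mono ((hZ p.1).integrable_mul (hW p.2)).norm
      ((hZ p.1).integrable_sq.add (hW p.2).integrable_sq) fun ω => ?_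
    simp only [norm_mul, Real.norm_eq_abs]
    nlinarith [two_mul_le_add_sq (|Z p.1 ω|) (|W p.2 ω|), sq_abs (Z p.1 ω), sq_abs (W p.2 ω),
      sq_nonneg (Z p.1 ω), sq_nonneg (W p.2 ω)]
  rw [integral_integral_swap (f := fun (p : ℝ × ℝ) ω => Z p.1 ω * W p.2 ω) hint]
  refine integral_congr_ae (Eventually.of_forall fun ω => ?_)
  exact (integral_prod_mul (fun x => Z x ω) (fun y => W y ω)).symm

namespace IsFBM

variable {h : ℝ} {X : ℝ → Ω → ℝ}

lemma aestronglyMeasurable_increment (hX : IsFBM h X P) [SFinite P] (t : ℝ) (κ : Measure ℝ)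
    [SFinite κ] :
    AEStronglyMeasurable (fun p : ℝ × Ω => X t p.2 - X (t - p.1) p.2) (κ.prod P) := by
  refine aestronglyMeasurable_uncurry_of_continuous_paths
    (X := fun x ω => X t ω - X (t - x) ω)
    (fun x => (hX.aemeasurable t).sub (hX.aemeasurable (t - x))) ?_ κ
  filter_upwards [hX.continuous_paths] with ω hω
  fun_prop

lemma memLp_increment (hX : IsFBM h X P) (t s : ℝ) :
    MemLp (fun ω => X t ω - X s ω) 2 P :=
  (hX.memLp t).sub (hX.memLp s)

/-- Almost surely, the increments of a path over the last `x` units of time are integrable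
against the exponential distribution in `x`. -/
lemma ae_integrable_increment (hX : IsFBM h X P) [IsProbabilityMeasure P] (hh : 0 < h) {a : ℝ}
    (ha : 0 < a) (t : ℝ) :
    ∀ᵐ ω ∂P, Integrable (fun x => X t ω - X (t - x) ω) (expMeasure a) := by
  have := isProbabilityMeasure_expMeasure ha
  have hm := hX.aestronglyMeasurable_increment t (expMeasure a)
  have hint : Integrable (fun p : ℝ × Ω => X t p.2 - X (t - p.1) p.2)
      ((expMeasure a).prod P) := by
    refine (integrable_prod_iff hm).2 ⟨Eventually.of_forall fun x =>
      (hX.memLp_increment t (t - x)).integrable (by norm_num), ?_⟩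
    refine Integrable.mono' ((integrable_const 1).add
      (integrable_rpow_expMeasure ha (by positivity : 0 ≤ 2 * h))) hm.norm.integral_prod_right'
      (Eventually.of_forall fun x => ?_)
    have hi := hX.memLp_increment t (t - x)
    rw [Real.norm_of_nonneg (integral_nonneg fun _ => norm_nonneg _)]
    have h1 : ∫ _ : Ω, (1 : ℝ) ∂P = 1 := by simp
    have h2 := hX.integral_sq_sub hh t (t - x)
    rw [sub_sub_cancel] at h2
    simp only [Pi.add_apply]
    rw [← h2]
    nth_rw 1 [← h1]
    rw [← integral_add (integrable_const 1) hi.integrable_sq]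
    refine integral_mono (hi.integrable (by norm_num)).norm
      ((integrable_const 1).add hi.integrable_sq) fun ω => ?_
    simp only [Real.norm_eq_abs]
    nlinarith [sq_abs (X t ω - X (t - x) ω), sq_nonneg (|X t ω - X (t - x) ω| - 1)]
  exact hint.prod_left_ae

end IsFBM

namespace IsMFOU

variable {d : ℕ} {α ν H : Fin d → ℝ} {B Y : Fin d → ℝ → Ω → ℝ}

/-- The moving average representation of the fractional Ornstein-Uhlenbeck process. -/
lemma ae_eq_movingAverage (hY : IsMFOU α ν H B Y P) (hα : ∀ i, 0 < α i) (hH : ∀ i, 0 < H i)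
    (i : Fin d) (t : ℝ) :
    ∀ᵐ ω ∂P, Y i t ω = ν i * ∫ x, (B i t ω - B i (t - x) ω) ∂(expMeasure (α i)) := by
  have := hY.gaussian.isProbabilityMeasure
  filter_upwards [hY.integral_eq i t, (hY.mfbm.component i).continuous_paths,
    (hY.mfbm.component i).ae_integrable_increment (hH i) (hα i) t] with ω ⟨I, hI, hYI⟩ hc hint
  rw [hYI, hI.eq_integral_expMeasure (hα i) hc hint]

lemma covariance_eq_integral_prod (hY : IsMFOU α ν H B Y P) (hα : ∀ i, 0 < α i)
    (hH : ∀ i, 0 < H i) (i j : Fin d) (t s : ℝ) :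
    covariance (Y i t) (Y j s) P = ν i * ν j *
      ∫ p : ℝ × ℝ, (covariance (B i t) (B j s) P - covariance (B i t) (B j (s - p.2)) P -
        covariance (B i (t - p.1)) (B j s) P + covariance (B i (t - p.1)) (B j (s - p.2)) P)
        ∂((expMeasure (α i)).prod (expMeasure (α j))) := by
  have := hY.gaussian.isProbabilityMeasure
  have := isProbabilityMeasure_expMeasure (hα i)
  have := isProbabilityMeasure_expMeasure (hα j)
  have hBi := hY.mfbm.component i
  have hBj := hY.mfbm.component j
  have h1 : covariance (Y i t) (Y j s) P =
      ∫ ω, ν i * ν j * ((∫ x, (B i t ω - B i (t - x) ω) ∂(expMeasure (α i))) *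
        ∫ y, (B j s ω - B j (s - y) ω) ∂(expMeasure (α j))) ∂P := by
    rw [covariance, hY.centered, hY.centered]
    refine integral_congr_ae ?_
    filter_upwards [hY.ae_eq_movingAverage hα hH i t, hY.ae_eq_movingAverage hα hH j s]
      with ω h1 h2
    rw [h1, h2]; ring
  rw [h1, integral_const_mul, integral_integral_mul_integral
    (hBi.aestronglyMeasurable_increment t _) (hBj.aestronglyMeasurable_increment s _)
    (fun x => hBi.memLp_increment t (t - x)) (fun y => hBj.memLp_increment s (s - y))
    (u := fun x => |x| ^ (2 * H i)) (v := fun y => |y| ^ (2 * H j))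
    (fun x => by rw [hBi.integral_sq_sub (hH i), sub_sub_cancel])
    (fun y => by rw [hBj.integral_sq_sub (hH j), sub_sub_cancel])
    (integrable_rpow_expMeasure (hα i) (mul_pos two_pos (hH i)).le)
    (integrable_rpow_expMeasure (hα j) (mul_pos two_pos (hH j)).le)]
  congr 1
  refine integral_congr_ae (Eventually.of_forall fun p => ?_)
  dsimp only
  rw [← covariance_fun_sub_fun_sub (hBi.memLp t) (hBi.memLp _) (hBj.memLp s) (hBj.memLp _),
    covariance]
  have int : ∀ k r, Integrable (B k r) P :=
    fun k r => ((hY.mfbm.component k).memLp r).integrable (by norm_num)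
  rw [integral_sub (int i t) (int i _), integral_sub (int j s) (int j _)]
  simp [hBi.centered, hBj.centered]

end IsMFOU

end MovingAverage

/-! ### Exponential averages of functions of quadratic growth -/

section ExpAverage

variable {a b K : ℝ} {f : ℝ → ℝ}

lemma integrable_sq_expMeasure (ha : 0 < a) : Integrable (fun x : ℝ => x ^ 2) (expMeasure a) := by
  have := integrable_rpow_expMeasure ha zero_le_two
  simpa using this

lemma abs_comp_add_mul_le (hK : 0 ≤ K) (hf : ∀ x, |f x| ≤ K * (1 + x ^ 2)) {σ : ℝ}
    (hσ : σ ^ 2 = 1) (s x : ℝ) :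
    |f (s + σ * x)| ≤ K * (1 + 2 * s ^ 2) + 2 * K * x ^ 2 := by
  refine (hf _).trans ?_
  have h1 : (s + σ * x) ^ 2 ≤ 2 * s ^ 2 + 2 * x ^ 2 := by
    have : (σ * x) ^ 2 = x ^ 2 := by rw [mul_pow, hσ, one_mul]
    nlinarith [sq_nonneg (s - σ * x)]
  nlinarith

lemma integrable_comp_add_mul (ha : 0 < a) (hc : Continuous f)
    (hf : ∀ x, |f x| ≤ K * (1 + x ^ 2)) {σ : ℝ} (hσ : σ ^ 2 = 1) (s : ℝ) :
    Integrable (fun x => f (s + σ * x)) (expMeasure a) := by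
  have := isProbabilityMeasure_expMeasure ha
  have hK : 0 ≤ K := by simpa using (abs_nonneg _).trans (hf 0)
  refine Integrable.mono' ((integrable_const (K * (1 + 2 * s ^ 2))).add
    ((integrable_sq_expMeasure ha).const_mul (2 * K))) (by fun_prop)
    (Eventually.of_forall fun x => ?_)
  simpa only [Real.norm_eq_abs, Pi.add_apply] using abs_comp_add_mul_le hK hf hσ s x

lemma integrable_comp_add (ha : 0 < a) (hc : Continuous f)
    (hf : ∀ x, |f x| ≤ K * (1 + x ^ 2)) (s : ℝ) :
    Integrable (fun x => f (s + x)) (expMeasure a) := by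
  simpa only [one_mul] using integrable_comp_add_mul ha hc hf (one_pow 2) s

lemma integrable_comp_sub (ha : 0 < a) (hc : Continuous f)
    (hf : ∀ x, |f x| ≤ K * (1 + x ^ 2)) (s : ℝ) :
    Integrable (fun x => f (s - x)) (expMeasure a) := by
  simpa only [neg_one_mul, ← sub_eq_add_neg] using
    integrable_comp_add_mul ha hc hf (neg_one_sq) s

/-- The exponential average of a function of quadratic growth has quadratic growth. -/
lemma exists_abs_integral_comp_add_le (ha : 0 < a) (hf : ∀ x, |f x| ≤ K * (1 + x ^ 2)) :
    ∃ L, ∀ s, |∫ x, f (s + x) ∂(expMeasure a)| ≤ L * (1 + s ^ 2) := by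
  have := isProbabilityMeasure_expMeasure ha
  have hK : 0 ≤ K := by simpa using (abs_nonneg _).trans (hf 0)
  set m := ∫ x, x ^ 2 ∂(expMeasure a) with hm
  have hm0 : 0 ≤ m := integral_nonneg fun x => sq_nonneg x
  refine ⟨2 * K + 2 * K * m, fun s => ?_⟩
  have hi : Integrable (fun x => K * (1 + 2 * s ^ 2) + 2 * K * x ^ 2) (expMeasure a) :=
    (integrable_const _).add ((integrable_sq_expMeasure ha).const_mul (2 * K))
  calc |∫ x, f (s + x) ∂(expMeasure a)|
      ≤ ∫ x, (K * (1 + 2 * s ^ 2) + 2 * K * x ^ 2) ∂(expMeasure a) := by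
        rw [← Real.norm_eq_abs]
        refine norm_integral_le_of_norm_le hi (Eventually.of_forall fun x => ?_)
        simpa only [one_mul, Real.norm_eq_abs] using abs_comp_add_mul_le hK hf (one_pow 2) s x
    _ = K * (1 + 2 * s ^ 2) + 2 * K * m := by
        rw [integral_add (integrable_const _) ((integrable_sq_expMeasure ha).const_mul (2 * K)),
          integral_const, probReal_univ, one_smul, integral_const_mul]
    _ ≤ (2 * K + 2 * K * m) * (1 + s ^ 2) := by
        have : 0 ≤ K * m * s ^ 2 := by positivity
        nlinarith

lemma hasDerivAt_integral_comp_add (ha : 0 < a) (hc : Continuous f)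
    (hf : ∀ x, |f x| ≤ K * (1 + x ^ 2)) (s : ℝ) :
    HasDerivAt (fun s => ∫ x, f (s + x) ∂(expMeasure a))
      (a * ((∫ x, f (s + x) ∂(expMeasure a)) - f s)) s := by
  set g : ℝ → ℝ := fun u => a * (Real.exp (-(a * u)) * f u) with hg
  have hgc : Continuous g := by fun_prop
  have hgi : ∀ c, IntegrableOn g (Set.Ioi c) := by
    have h0 : IntegrableOn g (Set.Ioi 0) := by
      have := integrable_comp_add ha hc hf 0
      simp only [zero_add] at this
      exact ((integrable_expMeasure_iff ha f).1 this).const_mul a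
    intro c
    refine ((hgc.integrableOn_Icc (a := c) (b := 0)).union h0).mono_set fun x hx => ?_
    rcases le_or_gt x 0 with h | h
    · exact Or.inl ⟨le_of_lt hx, h⟩
    · exact Or.inr h
  have hrep : ∀ s, ∫ x, f (s + x) ∂(expMeasure a) =
      Real.exp (a * s) * ((∫ u in Set.Ioi 0, g u) - ∫ u in (0 : ℝ)..s, g u) := by
    intro s
    have h1 := (measurePreserving_add_left volume s).setIntegral_preimage_emb
      (measurableEmbedding_addLeft s) g (Set.Ioi s)
    have h2 : (fun x => s + x) ⁻¹' (Set.Ioi s) = Set.Ioi 0 := by ext x; simp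
    have h3 := intervalIntegral.integral_Ioi_sub_Ioi' (hgi 0) (hgi s)
    rw [h2] at h1
    rw [integral_expMeasure ha, ← h3, sub_sub_cancel, ← h1, ← integral_const_mul]
    refine integral_congr_ae (Eventually.of_forall fun x => ?_)
    simp only [hg]
    have : Real.exp (-(a * x)) = Real.exp (a * s) * Real.exp (-(a * (s + x))) := by
      rw [← Real.exp_add]; congr 1; ring
    rw [this]; ring
  have hd1 : HasDerivAt (fun s => Real.exp (a * s)) (Real.exp (a * s) * a) s := by
    simpa using ((hasDerivAt_id' s).const_mul a).exp
  have hd2 : HasDerivAt (fun s => (∫ u in Set.Ioi 0, g u) - ∫ u in (0 : ℝ)..s, g u) (-g s) s :=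
    (intervalIntegral.integral_hasDerivAt_right (hgc.intervalIntegrable _ _)
      (hgc.stronglyMeasurableAtFilter _ _) hgc.continuousAt).const_sub _
  have hd := hd1.mul hd2
  simp only [hrep]
  refine hd.congr_deriv ?_
  have : Real.exp (a * s) * Real.exp (-(a * s)) = 1 := by rw [← Real.exp_add]; simp
  simp only [hg]
  linear_combination (-a * f s) * this

/-- If `X` and `Z` are independent exponential variables with rates `a` and `b`, then `X - Z` is
distributed as `X` with probability `b / (a + b)` and as `-Z` with probability `a / (a + b)`.
In the proof `X` is averaged out; the resulting function solves a linear differential equation,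
and integration by parts in `Z` gives an equation for the double average. -/
lemma integral_integral_comp_sub_add (ha : 0 < a) (hb : 0 < b) (hc : Continuous f)
    (hf : ∀ x, |f x| ≤ K * (1 + x ^ 2)) (s : ℝ) :
    ∫ y, ∫ x, f (s - y + x) ∂(expMeasure a) ∂(expMeasure b) =
      (b * ∫ x, f (s + x) ∂(expMeasure a) + a * ∫ y, f (s - y) ∂(expMeasure b)) / (a + b) := by
  set p : ℝ → ℝ := fun s => ∫ x, f (s + x) ∂(expMeasure a) with hp
  have hpd : ∀ s, HasDerivAt p (a * (p s - f s)) s := hasDerivAt_integral_comp_add ha hc hf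
  have hpc : Continuous p := continuous_iff_continuousAt.2 fun s => (hpd s).continuousAt
  obtain ⟨L, hL⟩ := exists_abs_integral_comp_add_le ha hf
  have ip := integrable_comp_sub hb hpc hL s
  have jf := integrable_comp_sub hb hc hf s
  have hF : ∀ y, HasDerivAt (fun y => Real.exp (-(b * y)) * p (s - y))
      (-(b * Real.exp (-(b * y)) * p (s - y)) -
        (a / b) * (b * Real.exp (-(b * y)) * (p (s - y) - f (s - y)))) y := by
    intro y
    have h1 : HasDerivAt (fun y => Real.exp (-(b * y))) (Real.exp (-(b * y)) * (-b)) y := by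
      simpa only [mul_one] using ((hasDerivAt_id' y).const_mul b).fun_neg.exp
    have h2 : HasDerivAt (fun y => p (s - y)) (-(a * (p (s - y) - f (s - y)))) y :=
      (hpd (s - y)).comp_const_sub s y
    refine (h1.mul h2).congr_deriv ?_
    field_simp
    ring
  have e1 : IntegrableOn (fun y => b * Real.exp (-(b * y)) * p (s - y)) (Set.Ioi 0) := by
    simp only [mul_assoc]
    exact ((integrable_expMeasure_iff hb _).1 ip).const_mul b
  have e1n : IntegrableOn (fun y => -(b * Real.exp (-(b * y)) * p (s - y))) (Set.Ioi 0) := e1.neg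
  have e2 : IntegrableOn (fun y => b * Real.exp (-(b * y)) * (p (s - y) - f (s - y)))
      (Set.Ioi 0) := by
    simp only [mul_assoc]
    exact ((integrable_expMeasure_iff hb _).1 (ip.sub jf)).const_mul b
  have hlim : Tendsto (fun y => Real.exp (-(b * y)) * p (s - y)) atTop (𝓝 0) := by
    refine tendsto_zero_of_hasDerivAt_of_integrableOn_Ioi (a := 0) (fun y _ => hF y)
      (e1n.sub (e2.const_mul (a / b))) ((integrable_expMeasure_iff hb _).1 ip)
  have h := integral_Ioi_of_hasDerivAt_of_tendsto' (a := 0) (fun y _ => hF y)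
    (e1n.sub (e2.const_mul (a / b))) hlim
  rw [integral_sub e1n (e2.const_mul (a / b)), integral_const_mul, integral_neg,
    ← integral_expMeasure hb, ← integral_expMeasure hb (fun y => p (s - y) - f (s - y)),
    integral_sub ip jf] at h
  simp only [mul_zero, neg_zero, Real.exp_zero, one_mul, sub_zero, zero_sub] at h
  rw [eq_div_iff (add_pos ha hb).ne']
  field_simp at h
  linarith

end ExpAverage

/-! ### Asymptotic expansion of exponential averages -/

lemma exp_neg_mul_isBigO {a : ℝ} (ha : 0 < a) {u : ℝ → ℝ} {q : ℝ}
    (hu : u =O[atTop] fun s => s ^ q) (r : ℝ) :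
    (fun s => Real.exp (-(a * s)) * u s) =O[atTop] fun s => s ^ r := by
  have h1 : (fun s => Real.exp (-(a * s))) =O[atTop] fun s : ℝ => s ^ (r - q) := by
    simpa only [neg_mul] using (isLittleO_exp_neg_mul_rpow_atTop ha (r - q)).isBigO
  refine (h1.mul hu).congr' EventuallyEq.rfl ?_
  filter_upwards [eventually_gt_atTop 0] with s hs
  rw [← Real.rpow_add hs, sub_add_cancel]

section Expansion

variable {a K : ℝ} {f : ℝ → ℝ} {D : ℕ → ℝ → ℝ} {σ : ℝ}

/-- The part of the average where the argument of `f` is far from `s` is exponentially small. -/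
lemma integral_tail_isBigO (ha : 0 < a)
    (hf : ∀ x, |f x| ≤ K * (1 + x ^ 2)) (hσ : σ ^ 2 = 1) (r : ℝ) :
    (fun s => ∫ z in Set.Ioi (s / 2), a * Real.exp (-(a * z)) * f (s + σ * z))
      =O[atTop] fun s => s ^ r := by
  have hK : 0 ≤ K := by simpa using (abs_nonneg _).trans (hf 0)
  have ha2 : 0 < a / 2 := by linarith
  obtain ⟨m, hm⟩ : ∃ m, m = ∫ z in Set.Ioi 0, Real.exp (-(a / 2 * z)) * z ^ 2 := ⟨_, rfl⟩
  obtain ⟨m', hm'⟩ : ∃ m', m' = ∫ z in Set.Ioi 0, Real.exp (-(a / 2 * z)) := ⟨_, rfl⟩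
  have i1 : IntegrableOn (fun z => Real.exp (-(a / 2 * z)) * z ^ 2) (Set.Ioi 0) :=
    (integrable_expMeasure_iff ha2 _).1 (integrable_sq_expMeasure ha2)
  have i2 : IntegrableOn (fun z => Real.exp (-(a / 2 * z))) (Set.Ioi 0) := by
    have := isProbabilityMeasure_expMeasure ha2
    simpa using (integrable_expMeasure_iff ha2 (fun _ => 1)).1 (integrable_const _)
  set u : ℝ → ℝ := fun s => a * K * ((1 + 2 * s ^ 2) * m' + 2 * m) with hu
  have hbound : ∀ s, 0 ≤ s →
      |∫ z in Set.Ioi (s / 2), a * Real.exp (-(a * z)) * f (s + σ * z)| ≤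
        Real.exp (-(a / 4 * s)) * u s := by
    intro s hs
    set w : ℝ → ℝ := fun z => Real.exp (-(a / 4 * s)) * (a * K * ((1 + 2 * s ^ 2) *
      Real.exp (-(a / 2 * z)) + 2 * (Real.exp (-(a / 2 * z)) * z ^ 2))) with hw
    have hwi : IntegrableOn w (Set.Ioi 0) :=
      (((i2.const_mul _).add (i1.const_mul 2)).const_mul _).const_mul _
    have hw0 : ∀ z, 0 ≤ w z := fun z => by positivity
    calc |∫ z in Set.Ioi (s / 2), a * Real.exp (-(a * z)) * f (s + σ * z)|
        ≤ ∫ z in Set.Ioi (s / 2), w z := by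
          rw [← Real.norm_eq_abs]
          refine norm_integral_le_of_norm_le
            (hwi.mono_set (Set.Ioi_subset_Ioi (by linarith))) ?_
          filter_upwards [ae_restrict_mem measurableSet_Ioi] with z hz
          have hz' : s / 2 < z := hz
          -- half of the exponential decay gives the smallness in `s`, as `z > s / 2`,
          -- and the other half the integrability in `z`
          have h1 : Real.exp (-(a * z)) ≤ Real.exp (-(a / 4 * s)) * Real.exp (-(a / 2 * z)) := by
            rw [← Real.exp_add]
            gcongr
            nlinarith
          have h2 := abs_comp_add_mul_le hK hf hσ s z
          rw [Real.norm_eq_abs, abs_mul, abs_of_nonneg (by positivity)]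
          calc a * Real.exp (-(a * z)) * |f (s + σ * z)|
              ≤ a * (Real.exp (-(a / 4 * s)) * Real.exp (-(a / 2 * z))) *
                (K * (1 + 2 * s ^ 2) + 2 * K * z ^ 2) := by gcongr
            _ = w z := by simp only [hw]; ring
      _ ≤ ∫ z in Set.Ioi 0, w z :=
          setIntegral_mono_set hwi (Eventually.of_forall hw0)
            (Set.Ioi_subset_Ioi (by linarith)).eventuallyLE
      _ = Real.exp (-(a / 4 * s)) * u s := by
          simp only [hw, hu, hm, hm']
          rw [integral_const_mul, integral_const_mul,
            integral_add (i2.const_mul _) (i1.const_mul 2), integral_const_mul,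
            integral_const_mul]
  have hu2 : u =O[atTop] fun s => s ^ (2 : ℝ) := by
    have h0 : (fun _ : ℝ => (1 : ℝ)) =O[atTop] fun s : ℝ => s ^ 2 := by
      refine IsBigO.of_bound 1 ?_
      filter_upwards [eventually_ge_atTop 1] with s hs
      rw [norm_one, one_mul, Real.norm_eq_abs, abs_of_nonneg (by positivity)]
      nlinarith
    have h1 : u = fun s => (a * K * m' + a * K * 2 * m) * 1 + (2 * a * K * m') * s ^ 2 := by
      ext s; simp only [hu]; ring
    simp only [Real.rpow_two]
    rw [h1]
    exact (h0.const_mul_left _).add ((isBigO_refl _ _).const_mul_left _)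
  refine IsBigO.trans (IsBigO.of_bound 1 ?_)
    (exp_neg_mul_isBigO (by positivity : 0 < a / 4) hu2 r)
  filter_upwards [eventually_ge_atTop 0] with s hs
  rw [one_mul, Real.norm_eq_abs, Real.norm_eq_abs]
  exact (hbound s hs).trans (le_abs_self _)

/-- One integration by parts on the part of the average where the argument of `D n` stays
in `[s / 2, 3 * s / 2]`. -/
lemma integral_head_eq (ha : 0 < a) (hσ : |σ| = 1)
    (hD : ∀ n x, 0 < x → HasDerivAt (D n) (D (n + 1) x) x) {s : ℝ} (hs : 0 < s) (n : ℕ) :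
    ∫ z in (0 : ℝ)..s / 2, a * Real.exp (-(a * z)) * D n (s + σ * z) =
      D n s - Real.exp (-(a / 2 * s)) * D n ((1 + σ / 2) * s) +
        (σ / a) * ∫ z in (0 : ℝ)..s / 2, a * Real.exp (-(a * z)) * D (n + 1) (s + σ * z) := by
  have hpos : ∀ z ∈ Set.uIcc 0 (s / 2), 0 < s + σ * z := by
    intro z hz
    rw [Set.uIcc_of_le (by linarith)] at hz
    have : |σ * z| ≤ s / 2 := by
      rw [abs_mul, hσ, one_mul, abs_of_nonneg hz.1]; exact hz.2
    linarith [neg_abs_le (σ * z)]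
  have hint : ∀ k, IntervalIntegrable (fun z => a * Real.exp (-(a * z)) * D k (s + σ * z)) volume 0
      (s / 2) := by
    intro k
    refine ContinuousOn.intervalIntegrable (ContinuousOn.mul (by fun_prop) fun z hz => ?_)
    refine ContinuousAt.continuousWithinAt ?_
    exact ContinuousAt.comp (f := fun z => s + σ * z) (hD k _ (hpos z hz)).continuousAt
      (by fun_prop)
  have hder : ∀ z ∈ Set.uIcc 0 (s / 2), HasDerivAt
      (fun z => -(Real.exp (-(a * z)) * D n (s + σ * z)))
      (a * Real.exp (-(a * z)) * D n (s + σ * z) -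
        (σ / a) * (a * Real.exp (-(a * z)) * D (n + 1) (s + σ * z))) z := by
    intro z hz
    have h1 : HasDerivAt (fun y => Real.exp (-(a * y))) (Real.exp (-(a * z)) * (-a)) z := by
      simpa only [mul_one] using ((hasDerivAt_id' z).const_mul a).fun_neg.exp
    have h2 : HasDerivAt (fun y => s + σ * y) σ z := by
      simpa only [mul_one] using ((hasDerivAt_id' z).const_mul σ).const_add s
    have h3 : HasDerivAt (fun y => D n (s + σ * y)) (D (n + 1) (s + σ * z) * σ) z :=
      (hD n _ (hpos z hz)).comp z h2
    refine (h1.mul h3).fun_neg.congr_deriv ?_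
    field_simp
    ring
  have h := intervalIntegral.integral_eq_sub_of_hasDerivAt hder
    ((hint n).sub ((hint (n + 1)).const_mul _))
  rw [intervalIntegral.integral_sub (hint n) ((hint (n + 1)).const_mul _),
    intervalIntegral.integral_const_mul] at h
  have e1 : s + σ * (s / 2) = (1 + σ / 2) * s := by ring
  have e2 : a * (s / 2) = a / 2 * s := by ring
  rw [e1, e2] at h
  simp only [mul_zero, neg_zero, Real.exp_zero, add_zero, one_mul] at h
  linarith

/-- Repeated integration by parts. -/
lemma integral_head_eq_sum (ha : 0 < a) (hσ : |σ| = 1)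
    (hD : ∀ n x, 0 < x → HasDerivAt (D n) (D (n + 1) x) x) {s : ℝ} (hs : 0 < s) (M : ℕ) :
    ∫ z in (0 : ℝ)..s / 2, a * Real.exp (-(a * z)) * D 0 (s + σ * z) =
      ∑ n ∈ Finset.range M,
        (σ / a) ^ n * (D n s - Real.exp (-(a / 2 * s)) * D n ((1 + σ / 2) * s)) +
      (σ / a) ^ M * ∫ z in (0 : ℝ)..s / 2, a * Real.exp (-(a * z)) * D M (s + σ * z) := by
  induction M with
  | zero => simp
  | succ M ih =>
    rw [ih, Finset.sum_range_succ, integral_head_eq ha hσ hD hs M]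
    ring

/-- For `z ≤ s / 2` the argument `s ± z` is at least `s / 2`, so the decay of `u` is preserved. -/
lemma integral_head_isBigO (ha : 0 < a) (hσ : |σ| = 1) {u : ℝ → ℝ} {r : ℝ} (hr : r ≤ 0)
    (hu : u =O[atTop] fun s => s ^ r) :
    (fun s => ∫ z in (0 : ℝ)..s / 2, a * Real.exp (-(a * z)) * u (s + σ * z))
      =O[atTop] fun s => s ^ r := by
  obtain ⟨c, hc0, hc⟩ := hu.exists_nonneg
  obtain ⟨x₀, hx₀⟩ := eventually_atTop.1 hc.bound
  refine IsBigO.of_bound (c * (1 / 2) ^ r) ?_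
  filter_upwards [eventually_gt_atTop 0, eventually_ge_atTop (2 * x₀)] with s hs hsx
  have hbd : ∀ z ∈ Set.Ioc 0 (s / 2), ‖a * Real.exp (-(a * z)) * u (s + σ * z)‖ ≤
      a * Real.exp (-(a * z)) * (c * (1 / 2) ^ r * s ^ r) := by
    intro z hz
    have h1 : |σ * z| ≤ s / 2 := by
      rw [abs_mul, hσ, one_mul, abs_of_pos hz.1]; exact hz.2
    have h2 : s / 2 ≤ s + σ * z := by linarith [neg_abs_le (σ * z)]
    have h3 := hx₀ (s + σ * z) (by linarith)
    have h4 : ‖(s + σ * z) ^ r‖ ≤ (1 / 2) ^ r * s ^ r := by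
      rw [Real.norm_of_nonneg (Real.rpow_nonneg (by linarith) _),
        ← Real.mul_rpow (by norm_num) hs.le]
      exact Real.rpow_le_rpow_of_nonpos (by linarith) (by linarith) hr
    rw [norm_mul, Real.norm_of_nonneg (by positivity)]
    have h5 := mul_le_mul_of_nonneg_left h4 hc0
    have h6 : 0 ≤ a * Real.exp (-(a * z)) := by positivity
    calc _ ≤ a * Real.exp (-(a * z)) * (c * ((1 / 2) ^ r * s ^ r)) := by
          gcongr; exact h3.trans h5
      _ = _ := by ring
  have hint : ∫ z in (0 : ℝ)..s / 2, a * Real.exp (-(a * z)) = 1 - Real.exp (-(a * (s / 2))) := by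
    have : ∀ z ∈ Set.uIcc 0 (s / 2), HasDerivAt (fun y => -Real.exp (-(a * y)))
        (a * Real.exp (-(a * z))) z := by
      intro z _
      refine ((hasDerivAt_id' z).const_mul a).fun_neg.exp.fun_neg.congr_deriv ?_
      ring
    rw [intervalIntegral.integral_eq_sub_of_hasDerivAt this
      (Continuous.intervalIntegrable (by fun_prop) _ _)]
    simp; ring
  refine (intervalIntegral.norm_integral_le_of_norm_le (by linarith)
    (Eventually.of_forall hbd) (Continuous.intervalIntegrable (by fun_prop) _ _)).trans ?_
  rw [intervalIntegral.integral_mul_const, hint, Real.norm_of_nonneg (Real.rpow_nonneg hs.le _)]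
  have : 0 ≤ c * (1 / 2) ^ r * s ^ r := by positivity
  nlinarith [Real.exp_pos (-(a * (s / 2)))]

/-- The asymptotic expansion of an exponential average in terms of derivatives. -/
lemma integral_expMeasure_sub_sum_isBigO (ha : 0 < a) (hc : Continuous f)
    (hf : ∀ x, |f x| ≤ K * (1 + x ^ 2)) (hσ : |σ| = 1) (hD0 : ∀ x, 0 < x → f x = D 0 x)
    (hD : ∀ n x, 0 < x → HasDerivAt (D n) (D (n + 1) x) x)
    (hDO : ∀ n, D n =O[atTop] fun x => x ^ (2 : ℝ)) {M : ℕ} {r : ℝ} (hr : r ≤ 0)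
    (hDM : D M =O[atTop] fun x => x ^ r) :
    (fun s => (∫ z, f (s + σ * z) ∂(expMeasure a)) - ∑ n ∈ Finset.range M, (σ / a) ^ n * D n s)
      =O[atTop] fun s => s ^ r := by
  have hσ2 : σ ^ 2 = 1 := by rw [← sq_abs, hσ, one_pow]
  have hσ1 : 0 < 1 + σ / 2 := by linarith [neg_abs_le σ]
  have hb : ∀ n, (fun s => Real.exp (-(a / 2 * s)) * D n ((1 + σ / 2) * s))
      =O[atTop] fun s => s ^ r := by
    intro n
    refine exp_neg_mul_isBigO (by positivity) (q := 2) ?_ r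
    have h1 := (hDO n).comp_tendsto (tendsto_id.const_mul_atTop hσ1)
    refine h1.trans (IsBigO.of_bound ((1 + σ / 2) ^ (2 : ℝ)) ?_)
    filter_upwards [eventually_gt_atTop 0] with s hs
    simp only [Function.comp, id]
    rw [Real.mul_rpow hσ1.le hs.le, norm_mul, Real.norm_of_nonneg (by positivity)]
  have hmain : (fun s => (∫ z in Set.Ioi (s / 2), a * Real.exp (-(a * z)) * f (s + σ * z)) +
      (σ / a) ^ M * (∫ z in (0 : ℝ)..s / 2, a * Real.exp (-(a * z)) * D M (s + σ * z)) -
      ∑ n ∈ Finset.range M, (σ / a) ^ n * (Real.exp (-(a / 2 * s)) * D n ((1 + σ / 2) * s)))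
      =O[atTop] fun s => s ^ r :=
    ((integral_tail_isBigO ha hf hσ2 r).add
      ((integral_head_isBigO ha hσ hr hDM).const_mul_left _)).sub
      (IsBigO.fun_sum fun n _ => (hb n).const_mul_left _)
  refine hmain.congr' ?_ EventuallyEq.rfl
  filter_upwards [eventually_gt_atTop 0] with s hs
  have hi := (integrable_expMeasure_iff ha _).1 (integrable_comp_add_mul ha hc hf hσ2 s)
  have hi' : IntegrableOn (fun z => a * Real.exp (-(a * z)) * f (s + σ * z)) (Set.Ioi 0) := by
    simp only [mul_assoc]
    exact hi.const_mul a
  have h1 := intervalIntegral.integral_Ioi_sub_Ioi hi' (by linarith : 0 ≤ s / 2)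
  have h2 : ∫ z in (0 : ℝ)..s / 2, a * Real.exp (-(a * z)) * f (s + σ * z) =
      ∫ z in (0 : ℝ)..s / 2, a * Real.exp (-(a * z)) * D 0 (s + σ * z) := by
    refine intervalIntegral.integral_congr fun z hz => ?_
    rw [Set.uIcc_of_le (by linarith)] at hz
    have h3 : |σ * z| ≤ s / 2 := by
      rw [abs_mul, hσ, one_mul, abs_of_nonneg hz.1]; exact hz.2
    rw [hD0 _ (by linarith [neg_abs_le (σ * z)])]
  rw [h2, integral_head_eq_sum ha hσ hD hs M] at h1
  simp only [mul_sub, Finset.sum_sub_distrib] at h1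
  rw [integral_expMeasure ha]
  linarith

end Expansion

/-! ### Growth and derivatives of the kernel -/

lemma continuous_crossKernel {h : ℝ} (hh : 0 < h) (r e : ℝ) : Continuous (crossKernel h r e) :=
  (continuous_const.mul (continuous_abs.rpow_const fun _ => Or.inr hh.le)).add
    (continuous_const.mul (continuous_oddKernel hh))

lemma abs_rpow_le_one_add_sq {h : ℝ} (hh : 0 < h) (h2 : h < 2) (x : ℝ) :
    |x| ^ h ≤ 1 + x ^ 2 := by
  rcases le_total |x| 1 with hx | hx
  · have := Real.rpow_le_one (abs_nonneg x) hx hh.le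
    nlinarith [sq_nonneg x]
  · have := Real.rpow_le_rpow_of_exponent_le hx h2.le
    rw [Real.rpow_two, sq_abs] at this
    linarith

lemma abs_oddKernel_le {h : ℝ} (hh : 0 < h) (h2 : h < 2) (x : ℝ) :
    |oddKernel h x| ≤ 1 + x ^ 2 := by
  unfold oddKernel
  split_ifs
  · rcases eq_or_ne x 0 with rfl | hx0
    · simp
    have hx0' : 0 < |x| := abs_pos.2 hx0
    rcases le_total |x| 1 with hx | hx
    · have := Real.abs_log_mul_self_lt |x| hx0' hx
      rw [abs_mul, abs_abs, mul_comm] at this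
      rw [abs_mul]
      nlinarith [sq_nonneg x]
    · rw [abs_mul, abs_of_nonneg (Real.log_nonneg hx)]
      have := Real.log_le_self (abs_nonneg x)
      nlinarith [sq_abs x]
  · rw [abs_neg, abs_mul, abs_sgn, one_mul, abs_of_nonneg (by positivity)]
    exact abs_rpow_le_one_add_sq hh h2 x

lemma abs_crossKernel_le {h : ℝ} (hh : 0 < h) (h2 : h < 2) (r e x : ℝ) :
    |crossKernel h r e x| ≤ (|r| + |e|) * (1 + x ^ 2) := by
  have h3 := abs_rpow_le_one_add_sq hh h2 x
  have h4 := abs_oddKernel_le hh h2 x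
  calc |crossKernel h r e x| ≤ |r| * |x| ^ h + |e| * |oddKernel h x| := by
        refine (abs_add_le _ _).trans_eq ?_
        rw [abs_mul, abs_mul, abs_of_nonneg (by positivity : 0 ≤ |x| ^ h)]
    _ ≤ |r| * (1 + x ^ 2) + |e| * (1 + x ^ 2) := by gcongr
    _ = _ := by ring

/-- The `n`-th derivative of `c * x ^ h` on the positive half-line. -/
noncomputable def powDeriv (c h : ℝ) (n : ℕ) (x : ℝ) : ℝ :=
  c * (∏ k ∈ Finset.range n, (h - (k : ℝ))) * x ^ (h - (n : ℝ))

lemma hasDerivAt_powDeriv (c h : ℝ) (n : ℕ) {x : ℝ} (hx : 0 < x) :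
    HasDerivAt (powDeriv c h n) (powDeriv c h (n + 1) x) x := by
  refine ((Real.hasDerivAt_rpow_const (p := h - n) (Or.inl hx.ne')).const_mul
    (c * ∏ k ∈ Finset.range n, (h - (k : ℝ)))).congr_deriv ?_
  rw [powDeriv, Finset.prod_range_succ]
  push_cast
  rw [sub_add_eq_sub_sub]
  ring

lemma powDeriv_isBigO (c h : ℝ) (n : ℕ) :
    powDeriv c h n =O[atTop] fun x => x ^ (h - (n : ℝ)) :=
  (isBigO_refl _ _).const_mul_left _

lemma rpow_isBigO_rpow {p q : ℝ} (hpq : p ≤ q) :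
    (fun x : ℝ => x ^ p) =O[atTop] fun x => x ^ q := by
  refine IsBigO.of_bound 1 ?_
  filter_upwards [eventually_ge_atTop 1] with x hx
  have hx0 : 0 ≤ x := by linarith
  rw [one_mul, Real.norm_of_nonneg (Real.rpow_nonneg hx0 _),
    Real.norm_of_nonneg (Real.rpow_nonneg hx0 _)]
  exact Real.rpow_le_rpow_of_exponent_le hx hpq

/-- The `n`-th derivative of `r * x + e * x * log x` on the positive half-line. -/
noncomputable def mulLogDeriv (r e : ℝ) : ℕ → ℝ → ℝ
  | 0, x => r * x + e * (x * Real.log x)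
  | 1, x => r + e * (Real.log x + 1)
  | n + 2, x => e * (∏ k ∈ Finset.range n, (-(k : ℝ) - 1)) * x ^ (-1 - (n : ℝ))

lemma hasDerivAt_mulLogDeriv (r e : ℝ) (n : ℕ) {x : ℝ} (hx : 0 < x) :
    HasDerivAt (mulLogDeriv r e n) (mulLogDeriv r e (n + 1) x) x := by
  match n with
  | 0 =>
    refine (((hasDerivAt_id' x).const_mul r).add
      ((Real.hasDerivAt_mul_log hx.ne').const_mul e)).congr_deriv ?_
    simp [mulLogDeriv]
  | 1 =>
    refine ((((Real.hasDerivAt_log hx.ne').add_const 1).const_mul e).const_add r).congr_deriv ?_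
    simp [mulLogDeriv, Real.rpow_neg_one]
  | n + 2 =>
    refine ((Real.hasDerivAt_rpow_const (p := -1 - n) (Or.inl hx.ne')).const_mul
      (e * ∏ k ∈ Finset.range n, (-(k : ℝ) - 1))).congr_deriv ?_
    rw [mulLogDeriv, Finset.prod_range_succ]
    push_cast
    rw [sub_add_eq_sub_sub]
    ring

lemma mulLogDeriv_add_two_isBigO (r e : ℝ) (n : ℕ) :
    mulLogDeriv r e (n + 2) =O[atTop] fun x => x ^ (-1 - (n : ℝ)) :=
  (isBigO_refl _ _).const_mul_left _

lemma mulLogDeriv_isBigO (r e : ℝ) (n : ℕ) :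
    mulLogDeriv r e n =O[atTop] fun x => x ^ (2 : ℝ) := by
  have hlog : Real.log =O[atTop] fun x : ℝ => x ^ (1 : ℝ) :=
    (isLittleO_log_rpow_atTop one_pos).isBigO
  have hone : (fun _ : ℝ => (1 : ℝ)) =O[atTop] fun x : ℝ => x ^ (1 : ℝ) := by
    simpa using rpow_isBigO_rpow zero_le_one
  have hx : (fun x : ℝ => x) =O[atTop] fun x : ℝ => x ^ (2 : ℝ) := by
    simpa using rpow_isBigO_rpow one_le_two
  match n with
  | 0 =>
    have h1 : (fun x => x * Real.log x) =O[atTop] fun x : ℝ => x ^ (2 : ℝ) := by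
      refine ((isBigO_refl (fun x : ℝ => x) atTop).mul hlog).congr_right fun x => ?_
      rw [Real.rpow_one, Real.rpow_two, sq]
    exact (hx.const_mul_left r).add (h1.const_mul_left e)
  | 1 =>
    refine IsBigO.trans ?_ (rpow_isBigO_rpow one_le_two)
    have h1 : (fun _ : ℝ => r) =O[atTop] fun x : ℝ => x ^ (1 : ℝ) := by
      simpa using hone.const_mul_left r
    exact h1.add ((hlog.add hone).const_mul_left e)
  | n + 2 =>
    refine (mulLogDeriv_add_two_isBigO r e n).trans (rpow_isBigO_rpow ?_)
    have : (0 : ℝ) ≤ n := n.cast_nonneg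
    linarith

lemma crossKernel_of_ne_one {h : ℝ} (h1 : h ≠ 1) (r e : ℝ) {x : ℝ} (hx : 0 < x) :
    crossKernel h r e x = powDeriv (r - e) h 0 x := by
  simp [crossKernel, oddKernel, powDeriv, h1, sgn, hx.le, abs_of_pos hx]
  ring

lemma crossKernel_one (r e : ℝ) {x : ℝ} (hx : 0 < x) :
    crossKernel 1 r e x = mulLogDeriv r e 0 x := by
  simp [crossKernel, oddKernel, mulLogDeriv, abs_of_pos hx]

/-! ### The cross-covariance of the fractional Ornstein-Uhlenbeck process -/

section CrossCovariance

variable {Ω : Type*} [MeasurableSpace Ω] {P : Measure Ω} {d : ℕ} {α ν H : Fin d → ℝ}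
  {B Y : Fin d → ℝ → Ω → ℝ} {ρ η : Fin d → Fin d → ℝ}

namespace IsMFOU

/-- The cross-covariance at lag `s` in terms of the kernel `C`. In the averaged covariance of the
increments of `B`, the one-variable terms of `(C (-t) + C s - C (s - t)) / 2` cancel. -/
lemma covariance_eq_integral_expMeasure (hY : IsMFOU α ν H B Y P) (hα : ∀ i, 0 < α i)
    (hH : ∀ i, 0 < H i ∧ H i < 1) (hp : IsCrossParam H B P ρ η) {i j : Fin d} (hij : i ≠ j)
    (t s : ℝ) :
    covariance (Y i t) (Y j (t + s)) P = ν i * ν j / 2 *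
      ((α i * ∫ x, crossKernel (H i + H j) (ρ i j) (η i j) (s + x) ∂(expMeasure (α i)) +
        α j * ∫ y, crossKernel (H i + H j) (ρ i j) (η i j) (s - y) ∂(expMeasure (α j))) /
          (α i + α j) - crossKernel (H i + H j) (ρ i j) (η i j) s) := by
  have hh : 0 < H i + H j := add_pos (hH i).1 (hH j).1
  have hh2 : H i + H j < 2 := by linarith [(hH i).2, (hH j).2]
  set C := crossKernel (H i + H j) (ρ i j) (η i j) with hC
  have hc : Continuous C := continuous_crossKernel hh _ _
  have hf : ∀ x, |C x| ≤ _ := abs_crossKernel_le hh hh2 _ _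
  set K := |ρ i j| + |η i j| with hK
  have hK0 : 0 ≤ K := by positivity
  set κ := expMeasure (α i) with hκ
  set κ' := expMeasure (α j) with hκ'
  have : IsProbabilityMeasure κ := isProbabilityMeasure_expMeasure (hα i)
  have : IsProbabilityMeasure κ' := isProbabilityMeasure_expMeasure (hα j)
  have i1 : Integrable (fun p : ℝ × ℝ => C (s + p.1)) (κ.prod κ') :=
    (integrable_comp_add (hα i) hc hf s).comp_fst κ'
  have i2 : Integrable (fun p : ℝ × ℝ => C (s - p.2)) (κ.prod κ') :=
    (integrable_comp_sub (hα j) hc hf s).comp_snd κ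
  have i3 : Integrable (fun p : ℝ × ℝ => C (s - p.2 + p.1)) (κ.prod κ') := by
    refine Integrable.mono' (((integrable_const (K * (1 + 4 * s ^ 2))).add
      (((integrable_sq_expMeasure (hα j)).comp_snd κ).const_mul (4 * K))).add
      (((integrable_sq_expMeasure (hα i)).comp_fst κ').const_mul (2 * K)))
      (by fun_prop) (Eventually.of_forall fun p => ?_)
    simp only [Pi.add_apply, Real.norm_eq_abs]
    refine (hf _).trans ?_
    have : (s - p.2 + p.1) ^ 2 ≤ 4 * s ^ 2 + 4 * p.2 ^ 2 + 2 * p.1 ^ 2 := by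
      nlinarith [sq_nonneg (s - p.2 - p.1), sq_nonneg (s + p.2)]
    nlinarith
  have i4 : Integrable (fun p : ℝ × ℝ => C (s + p.1) + C (s - p.2)) (κ.prod κ') := i1.add i2
  have i5 : Integrable (fun p : ℝ × ℝ => C (s + p.1) + C (s - p.2) - C s) (κ.prod κ') :=
    i4.sub (integrable_const _)
  have h1 : ∫ p : ℝ × ℝ, C (s + p.1) ∂(κ.prod κ') = ∫ x, C (s + x) ∂κ := by
    rw [integral_fun_fst (fun x => C (s + x)), probReal_univ, one_smul]
  have h2 : ∫ p : ℝ × ℝ, C (s - p.2) ∂(κ.prod κ') = ∫ y, C (s - y) ∂κ' := by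
    rw [integral_fun_snd (fun y => C (s - y)), probReal_univ, one_smul]
  have h3 : ∫ p : ℝ × ℝ, C (s - p.2 + p.1) ∂(κ.prod κ') =
      (α j * ∫ x, C (s + x) ∂κ + α i * ∫ y, C (s - y) ∂κ') / (α i + α j) := by
    rw [integral_prod_symm _ i3]
    exact integral_integral_comp_sub_add (hα i) (hα j) hc hf s
  have h4 : ∀ p : ℝ × ℝ, covariance (B i t) (B j (t + s)) P -
      covariance (B i t) (B j (t + s - p.2)) P - covariance (B i (t - p.1)) (B j (t + s)) P +
      covariance (B i (t - p.1)) (B j (t + s - p.2)) P =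
      (1 / 2) * (C (s + p.1) + C (s - p.2) - C s - C (s - p.2 + p.1)) := by
    intro p
    simp only [hp.covariance_eq i j hij, mfbmCrossCov_eq_crossKernel hh, ← hC]
    have e1 : t + s - t = s := by ring
    have e2 : t + s - p.2 - t = s - p.2 := by ring
    have e3 : t + s - (t - p.1) = s + p.1 := by ring
    have e4 : t + s - p.2 - (t - p.1) = s - p.2 + p.1 := by ring
    rw [e1, e2, e3, e4]
    ring
  have hsum : 0 < α i + α j := add_pos (hα i) (hα j)
  rw [hY.covariance_eq_integral_prod hα (fun i => (hH i).1)]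
  simp only [h4, ← hκ, ← hκ']
  rw [integral_const_mul, integral_sub i5 i3, integral_sub i4 (integrable_const _),
    integral_add i1 i2, integral_const,
    probReal_univ, one_smul, h1, h2, h3]
  field_simp
  ring

/-- The expansion of the cross-covariance in terms of the derivatives `D n` of the kernel. The
terms of order `0` and `1` of the two exponential averages cancel. -/
lemma covariance_sub_sum_isBigO (hY : IsMFOU α ν H B Y P) (hα : ∀ i, 0 < α i)
    (hH : ∀ i, 0 < H i ∧ H i < 1) (hp : IsCrossParam H B P ρ η) {i j : Fin d} (hij : i ≠ j)
    (t : ℝ) {D : ℕ → ℝ → ℝ}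
    (hD0 : ∀ x, 0 < x → crossKernel (H i + H j) (ρ i j) (η i j) x = D 0 x)
    (hD : ∀ n x, 0 < x → HasDerivAt (D n) (D (n + 1) x) x)
    (hDO : ∀ n, D n =O[atTop] fun x => x ^ (2 : ℝ)) (N : ℕ) {r : ℝ} (hr : r ≤ 0)
    (hDN : D (N + 3) =O[atTop] fun x => x ^ r) :
    (fun s => covariance (Y i t) (Y j (t + s)) P - ν i * ν j / (2 * (α i + α j)) *
      ∑ n ∈ Finset.range (N + 1),
        ((-1) ^ n / α j ^ (n + 1) + 1 / α i ^ (n + 1)) * D (n + 2) s)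
      =O[atTop] fun s => s ^ r := by
  have hh : 0 < H i + H j := add_pos (hH i).1 (hH j).1
  have hh2 : H i + H j < 2 := by linarith [(hH i).2, (hH j).2]
  have hai := (hα i).ne'
  have haj := (hα j).ne'
  have hsum : α i + α j ≠ 0 := (add_pos (hα i) (hα j)).ne'
  have hc := continuous_crossKernel hh (ρ i j) (η i j)
  have hf := abs_crossKernel_le hh hh2 (ρ i j) (η i j)
  have f1 := integral_expMeasure_sub_sum_isBigO (hα i) hc hf abs_one hD0 hD hDO hr hDN
  have f2 := integral_expMeasure_sub_sum_isBigO (σ := -1) (hα j) hc hf (by simp) hD0 hD hDO hr hDN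
  refine (((f1.const_mul_left (α i)).add (f2.const_mul_left (α j))).const_mul_left
    (ν i * ν j / (2 * (α i + α j)))).congr' ?_ EventuallyEq.rfl
  filter_upwards [eventually_gt_atTop 0] with s hs
  rw [hY.covariance_eq_integral_expMeasure hα hH hp hij, hD0 s hs, Finset.sum_range_succ',
    Finset.sum_range_succ', Finset.sum_range_succ' (fun n => (-1 / α j) ^ n * D n s),
    Finset.sum_range_succ' (fun n => (-1 / α j) ^ (n + 1) * D (n + 1) s)]
  have e1 : ∑ n ∈ Finset.range (N + 1),
      ((-1) ^ n / α j ^ (n + 1) + 1 / α i ^ (n + 1)) * D (n + 2) s =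
      α j * ∑ n ∈ Finset.range (N + 1), (-1 / α j) ^ (n + 1 + 1) * D (n + 1 + 1) s +
      α i * ∑ n ∈ Finset.range (N + 1), (1 / α i) ^ (n + 1 + 1) * D (n + 1 + 1) s := by
    rw [Finset.mul_sum, Finset.mul_sum, ← Finset.sum_add_distrib]
    refine Finset.sum_congr rfl fun n _ => ?_
    rw [div_pow, div_pow, one_pow, pow_succ' (α j) (n + 1), pow_succ' (α i) (n + 1)]
    field_simp
    ring
  rw [e1]
  simp only [one_mul, neg_one_mul, ← sub_eq_add_neg, zero_add, pow_zero, pow_one]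
  field_simp
  ring

end IsMFOU

end CrossCovariance

theorem theorem2p3 {Ω : Type*} [MeasurableSpace Ω] (P : Measure Ω) [IsProbabilityMeasure P]
    {d : ℕ} (α ν H : Fin d → ℝ) (hα : ∀ i, 0 < α i) (hν : ∀ i, 0 < ν i)
    (hH : ∀ i, 0 < H i ∧ H i < 1 ∧ H i ≠ 1 / 2)
    (B Y : Fin d → ℝ → Ω → ℝ) (hY : IsMFOU α ν H B Y P) :
    (∃ ρ η : Fin d → Fin d → ℝ, IsCrossParam H B P ρ η) ∧
    ∀ ρ η : Fin d → Fin d → ℝ, IsCrossParam H B P ρ η →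
      ∀ i j : Fin d, i ≠ j → ∀ (N : ℕ) (t : ℝ),
        (H i + H j ≠ 1 →
          (fun s : ℝ => covariance (Y i t) (Y j (t + s)) P -
            ν i * ν j * (ρ i j + η j i) / (2 * (α i + α j)) *
              ∑ n ∈ Finset.range (N + 1),
                ((-1) ^ n / α j ^ (n + 1) + 1 / α i ^ (n + 1)) *
                  (∏ k ∈ Finset.range (n + 2), (H i + H j - (k : ℝ))) *
                  s ^ (H i + H j - 2 - (n : ℝ)))
          =O[atTop] fun s : ℝ => s ^ (H i + H j - (N : ℝ) - 3)) ∧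
        (H i + H j = 1 →
          (fun s : ℝ => covariance (Y i t) (Y j (t + s)) P -
            (ν i * ν j * η i j / (2 * α i * α j) * (1 / s) +
              ν i * ν j * η i j / (2 * (α i + α j)) *
              ∑ n ∈ Finset.Icc 1 N,
                ((-1) ^ n / α j ^ (n + 1) + 1 / α i ^ (n + 1)) *
                  (∏ k ∈ Finset.range n, (-(k : ℝ) - 1)) *
                  s ^ (-1 - (n : ℝ))))
          =O[atTop] fun s : ℝ => s ^ (-(N : ℝ) - 2)) := by
  have hH' : ∀ i, 0 < H i ∧ H i < 1 := fun i => ⟨(hH i).1, (hH i).2.1⟩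
  refine ⟨hY.mfbm.exists_isCrossParam hH', fun ρ η hp i j hij N t => ⟨fun h1 => ?_, fun h1 => ?_⟩⟩
  · have hh2 : H i + H j < 2 := by linarith [(hH' i).2, (hH' j).2]
    have hN : (0 : ℝ) ≤ N := N.cast_nonneg
    have key := hY.covariance_sub_sum_isBigO hα hH' hp hij t
      (D := powDeriv (ρ i j - η i j) (H i + H j))
      (fun x hx => crossKernel_of_ne_one h1 _ _ hx)
      (fun n x hx => hasDerivAt_powDeriv _ _ n hx)
      (fun n => (powDeriv_isBigO _ _ n).trans (rpow_isBigO_rpow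
        (by linarith [n.cast_nonneg (α := ℝ)])))
      N (r := H i + H j - (N : ℝ) - 3) (by linarith)
      ((powDeriv_isBigO _ _ (N + 3)).trans (rpow_isBigO_rpow (by push_cast; linarith)))
    refine key.congr_left fun s => ?_
    rw [hp.eta_antisymm j i hij.symm, ← sub_eq_add_neg, Finset.mul_sum, Finset.mul_sum]
    congr 1
    refine Finset.sum_congr rfl fun n _ => ?_
    have e : H i + H j - ((n + 2 : ℕ) : ℝ) = H i + H j - 2 - n := by push_cast; ring
    rw [powDeriv, e]
    ring
  · have hN : (0 : ℝ) ≤ N := N.cast_nonneg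
    have key := hY.covariance_sub_sum_isBigO hα hH' hp hij t
      (D := mulLogDeriv (ρ i j) (η i j))
      (fun x hx => by rw [h1]; exact crossKernel_one _ _ hx)
      (fun n x hx => hasDerivAt_mulLogDeriv _ _ n hx)
      (fun n => mulLogDeriv_isBigO _ _ n)
      N (r := -(N : ℝ) - 2) (by linarith)
      ((mulLogDeriv_add_two_isBigO _ _ (N + 1)).trans
        (rpow_isBigO_rpow (by push_cast; linarith)))
    refine key.congr_left fun s => ?_
    have hai := (hα i).ne'
    have haj := (hα j).ne'
    have hsum : α i + α j ≠ 0 := (add_pos (hα i) (hα j)).ne'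
    congr 1
    -- the term of index `0` is the one with the factor `1 / s`
    rw [Finset.range_eq_Ico, Finset.sum_eq_sum_Ico_succ_bot (Nat.succ_pos N), mul_add]
    congr 1
    · simp only [mulLogDeriv, Finset.range_zero, Finset.prod_empty, Nat.cast_zero, sub_zero,
        Real.rpow_neg_one, pow_zero, zero_add, pow_one]
      field_simp
    · rw [zero_add, Finset.mul_sum, Finset.mul_sum]
      refine Finset.sum_congr rfl fun n _ => ?_
      rw [mulLogDeriv]
      ring
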